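/- **Model.** Fix $0<p<1$, $0\le\mu<1$ and put $\nu=\frac{\mu-p}{1-p}$. In the generalized TASEP (GTASEP) on $\mathbb Z$ in discrete time, each site holds at most one particle. At every time step all clusters (maximal groups of neighbouring particles) are updated independently, from right to left: the first (rightmost) particle of a cluster jumps one site to the right with probability $p$; if a particle has jumped, the next one of the same cluster follows it with probability $\mu$; if a particle stays, all particles of the cluster behind it stay. Let $x_n(t)$ be the position of the particle with label $n$ at time $t\in\mathbb Z_{\ge0}$. The initial data are either *step*, $x_n(0)=-n$ for $n\in\mathbb Z_{>0}$, or *alternating*, $x_n(0)=-2n$ for $n\in\mathbb Z$. For a kernel $K$ on $\{1,\dots,m\}\times\mathbb Z$ the Fredholm determinant is defined by the series $$\det(1-K)=\sum_{k\ge0}\frac{(-1)^k}{k!}\sum_{z_1,\dots,z_k\in\{1,\dots,m\}\times\mathbb Z}\det\big[K(z_l,z_s)\big]_{1\le l,s\le k}.$$ **Theorem.** Let $n_1<\dots<n_m$ be labels of particles (positive integers for step, arbitrary integers for alternating initial data), $a_1,\dots,a_m\in\mathbb Z$ and $t\in\mathbb Z_{\ge0}$. Then $$\mathbb P\Big(\bigcap_{k=1}^m\{x_{n_k}(t)\ge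 a_k\}\Big)=\det\big(1-\bar P_aK_t\bar P_a\big)_{\ell^2(\{1,\dots,m\}\times\mathbb Z)},$$ where all the sums in the series converge absolutely, $\bar P_aK_t\bar P_a$ has the kernel $\mathbf 1_{x<a_k}\,K_t(n_k,x;n_l,y)\,\mathbf 1_{y<a_l}$, and $K_t=-\phi^*+\widetilde K_t$ with $$\phi^{*(n_k,n_l)}(x,y)=\mathbf 1_{n_l>n_k}\oint_{\Gamma_1}\frac{dv}{2\pi i}\,\frac{(\nu-1)(1-v)^{n_l+y-n_k-x-1}}{v^{n_l-n_k}(1-\nu v)^{n_l+y-n_k-x+1}},$$ and, for step initial data, $$\widetilde K_t(n_k,x;n_l,y)=\oint_{\Gamma_1}\frac{du}{2\pi i}\oint_{\Gamma_0}\frac{dv}{2\pi i}\,\frac{u^{n_k}(1-\mu u)^t(1-v)^{y+n_l}(1-\nu u)^{n_k+x-t-1}}{v^{n_l}(1-\mu v)^t(1-u)^{x+n_k+1}(1-\nu v)^{n_l+y-t}}\,\frac{1-\nu}{v-u},$$ while for alternating initial data $$\widetilde K_t(n_k,x;n_l,y)=\oint_{\Gamma_0}\frac{dv}{2\pi i}\,\frac{(1-v)^{y+n_l+n_k}(1-p+vp)^t}{v^{x+n_k+n_l+1}(1-\mu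 v)^t(1-\nu v)^{y+n_l+n_k-t}}.$$ Here $\Gamma_0$ is any anticlockwise simple (piecewise $C^1$) loop with $0$ inside and $1,1/\mu,1/\nu$ outside, $\Gamma_1$ is any anticlockwise simple loop with $1$ inside and $0,1/\nu$ outside ($1/\mu$ and $1/\nu$ only as far as they exist), and in the double integral each of the two loops lies outside the other. The loops may be chosen separately for every entry of the kernel. -/

import Mathlib

open MeasureTheory

noncomputable section

namespace GTASEP

/-! ### The stochastic process

Particles carry integer labels from a set `I`, with larger labels further to the left, and
`X t n ω` is the position of the particle with label `n` at time `t`. -/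

/-- The information available when the particle `n` decides about its jump in the update
`t → t + 1`: all positions up to time `t`, and the decisions already taken in this update by the
particles to its right (those with smaller labels). -/
@[reducible] def past {Ω : Type*} (I : Set ℤ) (X : ℕ → ℤ → Ω → ℤ) (t : ℕ) (n : ℤ) : MeasurableSpace Ω :=
  (⨆ s : ℕ, ⨆ _ : s ≤ t, ⨆ k : ℤ, ⨆ _ : k ∈ I, MeasurableSpace.comap (X s k) inferInstance) ⊔
    (⨆ k : ℤ, ⨆ _ : k ∈ I, ⨆ _ : k < n, MeasurableSpace.comap (X (t + 1) k) inferInstance)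

open Classical in
/-- The probability with which the particle `n` jumps in the update `t → t + 1`, given its past.
If the site in front of it is occupied (necessarily by the particle `n - 1` of the same cluster),
it follows that particle with probability `μ` if that particle has jumped, and it stays otherwise.
If the site in front of it is empty, it is the first particle of its cluster, and it jumps with
probability `p`. -/
def jumpProb {Ω : Type*} (p μ : ℝ) (I : Set ℤ) (X : ℕ → ℤ → Ω → ℤ) (t : ℕ) (n : ℤ) (ω : Ω) : ℝ :=
  if n - 1 ∈ I ∧ X t (n - 1) ω = X t n ω + 1 then
    (if X (t + 1) (n - 1) ω = X t (n - 1) ω + 1 then μ else 0)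
  else p

/-- `X` is the TASEP with generalized update with parameters `p`, `μ`, whose particles have the
labels `n ∈ I` and the initial positions `x₀ n`. Each particle moves by `0` or `1` in each update,
and the conditional probability of a jump, given the past of the decision, is `jumpProb`. -/
structure IsGTASEP {Ω : Type*} [MeasurableSpace Ω] (P : Measure Ω) (p μ : ℝ) (I : Set ℤ)
    (x₀ : ℤ → ℤ) (X : ℕ → ℤ → Ω → ℤ) : Prop where
  measurable : ∀ t : ℕ, ∀ n ∈ I, Measurable (X t n)
  init : ∀ n ∈ I, ∀ᵐ ω ∂P, X 0 n ω = x₀ n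
  step : ∀ t : ℕ, ∀ n ∈ I, ∀ᵐ ω ∂P, X (t + 1) n ω = X t n ω ∨ X (t + 1) n ω = X t n ω + 1
  jump : ∀ t : ℕ, ∀ n ∈ I,
    P[Set.indicator {ω | X (t + 1) n ω = X t n ω + 1} (fun _ => (1 : ℝ)) | past I X t n]
      =ᵐ[P] jumpProb p μ I X t n

/-- Step initial data: labels `1, 2, 3, …`, and the particle `n` starts at `-n`. -/
def IsStepGTASEP {Ω : Type*} [MeasurableSpace Ω] (P : Measure Ω) (p μ : ℝ)
    (X : ℕ → ℤ → Ω → ℤ) : Prop :=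
  IsGTASEP P p μ {n : ℤ | 1 ≤ n} (fun n => -n) X

/-- Alternating initial data: all integers are labels, and the particle `n` starts at `-2 n`. -/
def IsAltGTASEP {Ω : Type*} [MeasurableSpace Ω] (P : Measure Ω) (p μ : ℝ)
    (X : ℕ → ℤ → Ω → ℤ) : Prop :=
  IsGTASEP P p μ Set.univ (fun n => -2 * n) X

/-! ### Contours -/

/-- A simple closed piecewise continuously differentiable curve, parametrized by `[0, 1]`
(the values outside `[0, 1]` are irrelevant). -/
structure SimpleLoop where
  toFun : ℝ → ℂ
  closed : toFun 0 = toFun 1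
  simple : Set.InjOn toFun (Set.Ico 0 1)
  piecewise : ∃ S : Finset ℝ, ∀ a b : ℝ, 0 ≤ a → a < b → b ≤ 1 →
    (∀ s ∈ S, s ∉ Set.Ioo a b) → ContDiffOn ℝ 1 toFun (Set.Icc a b)

/-- The points of the curve. -/
def SimpleLoop.trace (γ : SimpleLoop) : Set ℂ := γ.toFun '' Set.Icc 0 1

/-- The normalized contour integral `∮_γ f(z) dz / (2πi)`. -/
def SimpleLoop.oint (γ : SimpleLoop) (f : ℂ → ℂ) : ℂ :=
  (2 * (Real.pi : ℂ) * Complex.I)⁻¹ * ∫ s in (0 : ℝ)..1, f (γ.toFun s) * deriv γ.toFun s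

/-- The winding number of `γ` around `z`, for a point `z` off the curve. -/
def SimpleLoop.windingNumber (γ : SimpleLoop) (z : ℂ) : ℂ := γ.oint (fun w => (w - z)⁻¹)

/-- `γ` is oriented anticlockwise and `z` lies inside it. -/
def SimpleLoop.Encloses (γ : SimpleLoop) (z : ℂ) : Prop :=
  z ∉ γ.trace ∧ γ.windingNumber z = 1

/-- `z` lies outside the loop `γ`. -/
def SimpleLoop.Excludes (γ : SimpleLoop) (z : ℂ) : Prop :=
  z ∉ γ.trace ∧ γ.windingNumber z = 0

/-- An anticlockwise simple loop with `0` inside and with `1`, `1/μ`, `1/ν` outside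
(the latter two as far as they exist). -/
def IsLoopAroundZero (μ ν : ℂ) (γ : SimpleLoop) : Prop :=
  γ.Encloses 0 ∧ ∀ z : ℂ, (z = 1 ∨ 1 - μ * z = 0 ∨ 1 - ν * z = 0) → γ.Excludes z

/-- An anticlockwise simple loop with `1` inside and with `0` and `1/ν` (if it exists) outside. -/
def IsLoopAroundOne (ν : ℂ) (γ : SimpleLoop) : Prop :=
  γ.Encloses 1 ∧ ∀ z : ℂ, (z = 0 ∨ 1 - ν * z = 0) → γ.Excludes z

/-- Each of the two loops lies outside the other one. -/
def MutuallyOutside (γ₀ γ₁ : SimpleLoop) : Prop :=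
  (∀ u ∈ γ₁.trace, γ₀.Excludes u) ∧ (∀ v ∈ γ₀.trace, γ₁.Excludes v)

/-! ### The kernels -/

/-- The parameter `ν = (μ - p) / (1 - p)`. -/
def nu (p μ : ℝ) : ℝ := (μ - p) / (1 - p)

/-- `φ^{*(n,n')}(x,y)`. -/
def phiStar (ν : ℂ) (γ₁ : SimpleLoop) (n x n' y : ℤ) : ℂ :=
  if n < n' then
    γ₁.oint fun v =>
      (ν - 1) * (1 - v) ^ (n' + y - n - x - 1) /
        (v ^ (n' - n) * (1 - ν * v) ^ (n' + y - n - x + 1))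
  else 0

/-- The double contour integral `K̃_t(n,x;n',y)` for step initial data. -/
def kTildeStep (μ ν : ℂ) (t : ℕ) (γ₀ γ₁ : SimpleLoop) (n x n' y : ℤ) : ℂ :=
  γ₁.oint fun u => γ₀.oint fun v =>
    (u ^ n * (1 - μ * u) ^ t * (1 - v) ^ (y + n') * (1 - ν * u) ^ (n + x - (t : ℤ) - 1)) /
      (v ^ n' * (1 - μ * v) ^ t * (1 - u) ^ (x + n + 1) * (1 - ν * v) ^ (n' + y - (t : ℤ))) *
      ((1 - ν) / (v - u))

/-- The single contour integral `K̃_t(n,x;n',y)` for alternating initial data. -/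
def kTildeAlt (p μ ν : ℂ) (t : ℕ) (γ₀ : SimpleLoop) (n x n' y : ℤ) : ℂ :=
  γ₀.oint fun v =>
    ((1 - v) ^ (y + n' + n) * (1 - p + v * p) ^ t) /
      (v ^ (x + n + n' + 1) * (1 - μ * v) ^ t * (1 - ν * v) ^ (y + n' + n - (t : ℤ)))

/-- `K_t = -φ* + K̃_t` for step initial data. -/
def kStep (p μ : ℝ) (t : ℕ) (γ₀ γ₁ : SimpleLoop) (n x n' y : ℤ) : ℂ :=
  -phiStar (nu p μ) γ₁ n x n' y + kTildeStep μ (nu p μ) t γ₀ γ₁ n x n' y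

/-- `K_t = -φ* + K̃_t` for alternating initial data. -/
def kAlt (p μ : ℝ) (t : ℕ) (γ₀ γ₁ : SimpleLoop) (n x n' y : ℤ) : ℂ :=
  -phiStar (nu p μ) γ₁ n x n' y + kTildeAlt p μ (nu p μ) t γ₀ n x n' y

/-- The projector `P̄_a(k,x) = 1_{x < a_k}`. -/
def projBelow {m : ℕ} (a : Fin m → ℤ) (z : Fin m × ℤ) : ℂ := if z.2 < a z.1 then 1 else 0

/-- The kernel of `P̄_a K P̄_a`. -/
def cutKernel {m : ℕ} (a : Fin m → ℤ) (K : Fin m × ℤ → Fin m × ℤ → ℂ) :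
    Fin m × ℤ → Fin m × ℤ → ℂ :=
  fun z w => projBelow a z * K z w * projBelow a w

/-! ### The Fredholm determinant -/

/-- The summand of the Fredholm series at the points `z 0, …, z (k-1)`. -/
def fredholmMinor {ι : Type*} (K : ι → ι → ℂ) (k : ℕ) (z : Fin k → ι) : ℂ :=
  (Matrix.of fun l s : Fin k => K (z l) (z s)).det

/-- The `k`-th term of the Fredholm series. -/
def fredholmTerm {ι : Type*} (K : ι → ι → ℂ) (k : ℕ) : ℂ :=
  (-1) ^ k / (k.factorial : ℂ) * ∑' z : Fin k → ι, fredholmMinor K k z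

/-- The Fredholm series of `det(1 - K)` converges absolutely: so does each of the inner sums, and
so does the outer one. -/
def FredholmSummable {ι : Type*} (K : ι → ι → ℂ) : Prop :=
  (∀ k : ℕ, Summable (fredholmMinor K k)) ∧ Summable (fredholmTerm K)

/-- The Fredholm determinant `det(1 - K)` on `ℓ²(ι)`, through its series. -/
def fredholmDet {ι : Type*} (K : ι → ι → ℂ) : ℂ := ∑' k : ℕ, fredholmTerm K k

end GTASEP

end

/-! The probability is found by running time backwards. Let `U` be a function of configurations,
also defined where exclusion fails, that satisfies `BoundaryAt` at neighbouring labels. One update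
of the interacting system then averages `U` as if all particles jumped independently with
probability `p`: the two-particle condition absorbs both the exclusion and the probability `μ` of
following, and the relation `ν (1 - p) = μ - p` lets it pass down a cluster (`stepExp_jumpDiff`,
`stepExp_eq_free`).

Such a function is `detSol`, a determinant with a row for each particle of a window and a row for
each point of a finite box. A particle row depends on one position and one remaining time. It solves
the free equation, and its linear relation between consecutive labels becomes `BoundaryAt` because a
determinant is alternating. With no time left, a particle `n k` left of `a k` has the row of the box
point on which it sits, provided that its label is the largest of this kind, and the determinant is
`0`; if there is no such particle, the matrix is unitriangular in a suitable order (`detSol_zero`).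
With time `t` left, the initial configuration allows the dual columns to be eliminated, and what
remains is `det (1 - K)` on the box (`detSol_eq_det_one_sub`). Comparing expectations at the times
`t` and `0` gives the formula (`measureReal_eq_detSol`).

The box loses nothing. Left of it `K` reduces to `-φ*`, which is strictly triangular in the labels,
so all minors of the cut kernel with a point outside the box vanish and the Fredholm series is a
finite sum (`fredholm_cutKernel`). Infinitely many particles are handled similarly: those far to the
right have zero `psi` entries, so the window may be extended to the head of a cluster
(`detSol_window`), and bounded speed provides a head at bounded distance.

The contour integrals become algebra in Laurent series. By partial fractions every integrand is a
combination of powers `(v - a) ^ k`; such a power has a primitive unless `k = -1`, where the winding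
number enters. Hence arbitrary loops need no deformation (`Expands.oint_zero`, `Expands.oint_one`).
-/

open MeasureTheory

noncomputable section

namespace GTASEP

section

open Set Filter Topology

/-! ### Contour integrals of rational functions -/

namespace SimpleLoop

variable (γ : SimpleLoop)

/-- On both sides of every parameter the loop is smooth up to the parameter. -/
lemma exists_contDiffOn (s : ℝ) : ∃ ε > 0,
    (∀ b ∈ Ioc s (s + ε), 0 ≤ s → b ≤ 1 → ContDiffOn ℝ 1 γ.toFun (Icc s b)) ∧
    (∀ a ∈ Ico (s - ε) s, 0 ≤ a → s ≤ 1 → ContDiffOn ℝ 1 γ.toFun (Icc a s)) := by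
  obtain ⟨S, hS⟩ := γ.piecewise
  have hfin : ((S : Set ℝ) \ {s}).Finite := S.finite_toSet.subset sdiff_subset
  have hnhds : ((S : Set ℝ) \ {s})ᶜ ∈ 𝓝 s := hfin.isClosed.isOpen_compl.mem_nhds (by simp)
  obtain ⟨ε, hε, hball⟩ := Metric.mem_nhds_iff.1 hnhds
  have key : ∀ r, |r - s| < ε → r ≠ s → r ∉ S := fun r hr hrs hrS =>
    hball (by simpa [Real.dist_eq] using hr) ⟨hrS, hrs⟩
  refine ⟨ε / 2, half_pos hε, fun b hb h0 h1 => hS s b h0 hb.1 h1 fun r hmem hr => ?_,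
    fun a ha h0 h1 => hS a s h0 ha.2 h1 fun r hmem hr => ?_⟩
  · exact key r (by rw [abs_lt]; constructor <;> linarith [hr.1, hr.2, hb.2]) hr.1.ne' hmem
  · exact key r (by rw [abs_lt]; constructor <;> linarith [hr.1, hr.2, ha.1]) hr.2.ne hmem

lemma exists_contDiffOn_right {s : ℝ} (hs : s ∈ Ico (0 : ℝ) 1) :
    ∃ b, s < b ∧ b ≤ 1 ∧ ContDiffOn ℝ 1 γ.toFun (Icc s b) := by
  obtain ⟨ε, hε, h, -⟩ := γ.exists_contDiffOn s
  have hb : s < min (s + ε) 1 := lt_min (by linarith) hs.2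
  exact ⟨_, hb, min_le_right _ _, h _ ⟨hb, min_le_left _ _⟩ hs.1 (min_le_right _ _)⟩

lemma exists_contDiffOn_left {s : ℝ} (hs : s ∈ Ioc (0 : ℝ) 1) :
    ∃ a, a < s ∧ 0 ≤ a ∧ ContDiffOn ℝ 1 γ.toFun (Icc a s) := by
  obtain ⟨ε, hε, -, h⟩ := γ.exists_contDiffOn s
  have ha : max (s - ε) 0 < s := max_lt (by linarith) hs.1
  exact ⟨_, ha, le_max_right _ _, h _ ⟨le_max_left _ _, ha⟩ (le_max_right _ _) hs.2⟩

lemma continuousOn : ContinuousOn γ.toFun (Icc 0 1) := by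
  intro s hs
  have hr : ContinuousWithinAt γ.toFun (Icc s 1) s := by
    rcases hs.2.eq_or_lt with h1 | h1
    · rw [h1, Icc_self]; exact continuousWithinAt_singleton
    · obtain ⟨b, hsb, -, hc⟩ := γ.exists_contDiffOn_right ⟨hs.1, h1⟩
      refine (hc.continuousOn s (left_mem_Icc.2 hsb.le)).mono_of_mem_nhdsWithin ?_
      exact mem_of_superset (Icc_mem_nhdsGE hsb) Subset.rfl |> fun h =>
        nhdsWithin_mono s Icc_subset_Ici_self h
  have hl : ContinuousWithinAt γ.toFun (Icc 0 s) s := by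
    rcases hs.1.eq_or_lt with h0 | h0
    · rw [← h0, Icc_self]; exact continuousWithinAt_singleton
    · obtain ⟨a, has, -, hc⟩ := γ.exists_contDiffOn_left ⟨h0, hs.2⟩
      refine (hc.continuousOn s (right_mem_Icc.2 has.le)).mono_of_mem_nhdsWithin ?_
      exact nhdsWithin_mono s Icc_subset_Iic_self (Icc_mem_nhdsLE has)
  have := hl.union hr
  rwa [Icc_union_Icc_eq_Icc hs.1 hs.2] at this

/-- At the end points `deriv` may differ from the one-sided derivative, but these form a null set.
Inside it agrees with `derivWithin`, which is continuous up to the ends. -/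
lemma integrableOn_deriv_of_contDiffOn {f : ℝ → ℂ} {a b : ℝ} (h : ContDiffOn ℝ 1 f (Icc a b)) :
    IntegrableOn (deriv f) (Icc a b) := by
  rcases le_or_gt b a with hab | hab
  · rcases hab.eq_or_lt with h' | h'
    · subst h'; simp
    · simp [Icc_eq_empty_of_lt h']
  have hc : ContinuousOn (derivWithin f (Icc a b)) (Icc a b) :=
    h.continuousOn_derivWithin (uniqueDiffOn_Icc hab) le_rfl
  have hi : IntegrableOn (derivWithin f (Icc a b)) (Icc a b) := hc.integrableOn_Icc
  rw [integrableOn_Icc_iff_integrableOn_Ioo] at hi ⊢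
  refine hi.congr_fun (fun x hx => ?_) measurableSet_Ioo
  exact derivWithin_of_mem_nhds (Icc_mem_nhds hx.1 hx.2)

lemma integrableOn_deriv : IntegrableOn (deriv γ.toFun) (Icc 0 1) := by
  refine LocallyIntegrableOn.integrableOn_isCompact (fun s hs => ?_) isCompact_Icc
  have hr : ∃ t ∈ 𝓝[Icc s 1] s, IntegrableOn (deriv γ.toFun) t := by
    rcases hs.2.eq_or_lt with h1 | h1
    · exact ⟨Icc s 1, self_mem_nhdsWithin, by simp [h1]⟩
    · obtain ⟨b, hsb, -, hc⟩ := γ.exists_contDiffOn_right ⟨hs.1, h1⟩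
      exact ⟨Icc s b, nhdsWithin_mono s Icc_subset_Ici_self (Icc_mem_nhdsGE hsb),
        integrableOn_deriv_of_contDiffOn hc⟩
  have hl : ∃ t ∈ 𝓝[Icc 0 s] s, IntegrableOn (deriv γ.toFun) t := by
    rcases hs.1.eq_or_lt with h0 | h0
    · exact ⟨Icc 0 s, self_mem_nhdsWithin, by simp [← h0]⟩
    · obtain ⟨a, has, -, hc⟩ := γ.exists_contDiffOn_left ⟨h0, hs.2⟩
      exact ⟨Icc a s, nhdsWithin_mono s Icc_subset_Iic_self (Icc_mem_nhdsLE has),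
        integrableOn_deriv_of_contDiffOn hc⟩
  obtain ⟨t₁, h₁, i₁⟩ := hr
  obtain ⟨t₂, h₂, i₂⟩ := hl
  refine ⟨t₂ ∪ t₁, ?_, i₂.union i₁⟩
  rw [← Icc_union_Icc_eq_Icc hs.1 hs.2, nhdsWithin_union]
  exact union_mem_sup h₂ h₁

lemma exists_countable_hasDerivAt : ∃ S : Set ℝ, S.Countable ∧
    ∀ s ∈ Ioo (0 : ℝ) 1 \ S, HasDerivAt γ.toFun (deriv γ.toFun s) s := by
  obtain ⟨S, hS⟩ := γ.piecewise
  refine ⟨S, S.countable_toSet, fun s hs => ?_⟩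
  have hnhds : ((S : Set ℝ))ᶜ ∩ Ioo 0 1 ∈ 𝓝 s :=
    inter_mem (S.finite_toSet.isClosed.isOpen_compl.mem_nhds hs.2) (Ioo_mem_nhds hs.1.1 hs.1.2)
  obtain ⟨ε, hε, hball⟩ := Metric.mem_nhds_iff.1 hnhds
  rw [Real.ball_eq_Ioo] at hball
  have hc := hS (s - ε / 2) (s + ε / 2)
    ((hball ⟨by linarith, by linarith⟩ : s - ε / 2 ∈ _).2.1.le) (by linarith)
    ((hball ⟨by linarith, by linarith⟩ : s + ε / 2 ∈ _).2.2.le)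
    fun r hr hmem => (hball ⟨by linarith [hmem.1], by linarith [hmem.2]⟩ : r ∈ _).1 hr
  exact ((hc.contDiffAt (Icc_mem_nhds (by linarith) (by linarith))).differentiableAt
    one_ne_zero).hasDerivAt

/-- The integrand of a contour integral is integrable. -/
def Integrable (f : ℂ → ℂ) : Prop :=
  IntervalIntegrable (fun s => f (γ.toFun s) * deriv γ.toFun s) volume 0 1

variable {γ}

lemma mem_trace {s : ℝ} (hs : s ∈ Icc (0 : ℝ) 1) : γ.toFun s ∈ γ.trace := mem_image_of_mem _ hs

lemma integrable_of_continuousOn {f : ℂ → ℂ} (hf : ContinuousOn f γ.trace) : γ.Integrable f := by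
  rw [Integrable, intervalIntegrable_iff_integrableOn_Icc_of_le zero_le_one]
  refine γ.integrableOn_deriv.continuousOn_mul ?_ isCompact_Icc
  exact hf.comp γ.continuousOn fun s hs => mem_trace hs

lemma oint_congr {f g : ℂ → ℂ} (h : ∀ z ∈ γ.trace, f z = g z) : γ.oint f = γ.oint g := by
  rw [oint, oint]
  congr 1
  refine intervalIntegral.integral_congr fun s hs => ?_
  rw [uIcc_of_le zero_le_one] at hs
  simp only [h _ (mem_trace hs)]

lemma integrable_congr {f g : ℂ → ℂ} (h : ∀ z ∈ γ.trace, f z = g z) (hf : γ.Integrable f) :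
    γ.Integrable g := by
  refine IntervalIntegrable.congr (fun s hs => ?_) hf
  rw [uIoc_of_le zero_le_one] at hs
  simp only [h _ (mem_trace (Ioc_subset_Icc_self hs))]

lemma Integrable.add {f g : ℂ → ℂ} (hf : γ.Integrable f) (hg : γ.Integrable g) :
    γ.Integrable fun z => f z + g z := by
  simpa only [Integrable, add_mul] using IntervalIntegrable.add hf hg

lemma Integrable.const_mul {f : ℂ → ℂ} (c : ℂ) (hf : γ.Integrable f) :
    γ.Integrable fun z => c * f z := by
  simpa only [Integrable, mul_assoc] using IntervalIntegrable.const_mul hf c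

lemma oint_add {f g : ℂ → ℂ} (hf : γ.Integrable f) (hg : γ.Integrable g) :
    γ.oint (fun z => f z + g z) = γ.oint f + γ.oint g := by
  simp only [oint, add_mul]
  rw [intervalIntegral.integral_add hf hg, mul_add]

lemma oint_const_mul (c : ℂ) (f : ℂ → ℂ) : γ.oint (fun z => c * f z) = c * γ.oint f := by
  simp only [oint, mul_assoc]
  rw [intervalIntegral.integral_const_mul]
  ring

lemma continuousOn_sub_zpow {a : ℂ} (ha : a ∉ γ.trace) (k : ℤ) :
    ContinuousOn (fun z => (z - a) ^ k) γ.trace := fun z hz =>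
  (((continuousAt_id.sub continuousAt_const).zpow₀ k
    (Or.inl (sub_ne_zero.2 fun h : z = a => ha (h ▸ hz)))).continuousWithinAt)

/-- The integrand has the single-valued primitive `(z - a) ^ (k + 1) / (k + 1)` along the closed
loop; the finitely many corners do not disturb the fundamental theorem of calculus. -/
lemma oint_sub_zpow {a : ℂ} (ha : a ∉ γ.trace) {k : ℤ} (hk : k ≠ -1) :
    γ.oint (fun z => (z - a) ^ k) = 0 := by
  obtain ⟨S, hS, hd⟩ := γ.exists_countable_hasDerivAt
  have hk' : ((k + 1 : ℤ) : ℂ) ≠ 0 := by exact_mod_cast fun h => hk (by omega)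
  have hF : ContinuousOn (fun s => (γ.toFun s - a) ^ (k + 1) / ((k + 1 : ℤ) : ℂ)) (uIcc 0 1) := by
    rw [uIcc_of_le zero_le_one]
    exact ((continuousOn_sub_zpow ha (k + 1)).comp γ.continuousOn
      fun s hs => mem_trace hs).div_const _
  have hint := MeasureTheory.integral_eq_of_hasDerivAt_off_countable
    (fun s => (γ.toFun s - a) ^ (k + 1) / ((k + 1 : ℤ) : ℂ))
    (fun s => (γ.toFun s - a) ^ k * deriv γ.toFun s) hS hF (fun s hs => ?_)
    (integrable_of_continuousOn (continuousOn_sub_zpow ha k))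
  · rw [oint, hint, γ.closed, sub_self, mul_zero]
  · rw [min_eq_left zero_le_one, max_eq_right zero_le_one] at hs
    have hne : γ.toFun s - a ≠ 0 :=
      sub_ne_zero.2 fun h => ha (h ▸ mem_trace (Ioo_subset_Icc_self hs.1))
    have h1 := ((hasDerivAt_zpow (k + 1) (γ.toFun s - a) (Or.inl hne)).comp s
      ((hd s hs).sub_const a)).div_const ((k + 1 : ℤ) : ℂ)
    refine h1.congr_deriv ?_
    rw [add_sub_cancel_right]
    field_simp

end SimpleLoop

end

section

open Set Filter Topology

open scoped LaurentSeries

/-! ### Laurent series -/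

/-- The Laurent series `L` is a power series with the constant coefficient `c`. -/
def HasConst (L : ℂ⸨X⸩) (c : ℂ) : Prop :=
  ∃ g : PowerSeries ℂ, L = HahnSeries.ofPowerSeries ℤ ℂ g ∧ PowerSeries.constantCoeff g = c

namespace HasConst

variable {L M : ℂ⸨X⸩} {c d : ℂ}

lemma coeff_neg (h : HasConst L c) {k : ℤ} (hk : k < 0) : L.coeff k = 0 := by
  obtain ⟨g, rfl, -⟩ := h
  rw [PowerSeries.coeff_coe, if_pos hk]

lemma coeff_zero (h : HasConst L c) : L.coeff 0 = c := by
  obtain ⟨g, rfl, rfl⟩ := h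
  rw [PowerSeries.coeff_coe]
  simp

lemma C (c : ℂ) : HasConst (HahnSeries.C c) c :=
  ⟨PowerSeries.C c, (PowerSeries.coe_C c).symm, by simp⟩

lemma one : HasConst 1 1 := ⟨1, by simp, by simp⟩

lemma X : HasConst (HahnSeries.single 1 1) 0 := ⟨PowerSeries.X, by simp, by simp⟩

lemma add (h : HasConst L c) (h' : HasConst M d) : HasConst (L + M) (c + d) := by
  obtain ⟨g, rfl, rfl⟩ := h
  obtain ⟨g', rfl, rfl⟩ := h'
  exact ⟨g + g', by simp, by simp⟩

lemma sub (h : HasConst L c) (h' : HasConst M d) : HasConst (L - M) (c - d) := by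
  obtain ⟨g, rfl, rfl⟩ := h
  obtain ⟨g', rfl, rfl⟩ := h'
  exact ⟨g - g', by simp, by simp⟩

lemma mul (h : HasConst L c) (h' : HasConst M d) : HasConst (L * M) (c * d) := by
  obtain ⟨g, rfl, rfl⟩ := h
  obtain ⟨g', rfl, rfl⟩ := h'
  exact ⟨g * g', by simp, by simp⟩

lemma ne_zero (h : HasConst L c) (hc : c ≠ 0) : L ≠ 0 := fun h0 =>
  hc (by rw [← h.coeff_zero, h0, HahnSeries.coeff_zero])

lemma inv (h : HasConst L c) (hc : c ≠ 0) : HasConst L⁻¹ c⁻¹ := by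
  have hne := h.ne_zero hc
  obtain ⟨g, rfl, rfl⟩ := h
  refine ⟨g⁻¹, ?_, by simp⟩
  refine inv_eq_of_mul_eq_one_right ?_
  rw [← map_mul, PowerSeries.mul_inv_cancel _ hc, map_one]

lemma pow (h : HasConst L c) (k : ℕ) : HasConst (L ^ k) (c ^ k) := by
  obtain ⟨g, rfl, rfl⟩ := h
  exact ⟨g ^ k, by simp, by simp⟩

lemma zpow (h : HasConst L c) (hc : c ≠ 0) (k : ℤ) : HasConst (L ^ k) (c ^ k) := by
  obtain ⟨k, rfl | rfl⟩ := k.eq_nat_or_neg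
  · simpa using h.pow k
  · simpa using (h.pow k).inv (pow_ne_zero k hc)

lemma zpow_one (h : HasConst L 1) (k : ℤ) : HasConst (L ^ k) 1 := by
  simpa using h.zpow one_ne_zero k

end HasConst

/-- The variable of the Laurent series. -/
def lX : ℂ⸨X⸩ := HahnSeries.single 1 1

lemma lX_ne_zero : lX ≠ 0 := by simp [lX]

lemma lX_zpow (k : ℤ) : lX ^ k = HahnSeries.single k 1 := by
  rw [lX, ← RatFunc.single_zpow]

lemma coeff_lX_zpow_mul (k i : ℤ) (L : ℂ⸨X⸩) : (lX ^ k * L).coeff i = L.coeff (i - k) := by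
  rw [lX_zpow, HahnSeries.coeff_single_mul, one_mul]

lemma hasConst_lX_sub (a : ℂ) : HasConst (lX - HahnSeries.C a) (-a) := by
  rw [← zero_sub]
  exact HasConst.X.sub (HasConst.C a)

lemma coeff_lX_zpow_mul_of_lt {L : ℂ⸨X⸩} {c : ℂ} (h : HasConst L c) {k i : ℤ} (hi : i < k) :
    (lX ^ k * L).coeff i = 0 := by
  rw [coeff_lX_zpow_mul, h.coeff_neg (by omega)]

lemma coeff_lX_zpow_mul_self {L : ℂ⸨X⸩} {c : ℂ} (h : HasConst L c) (k : ℤ) :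
    (lX ^ k * L).coeff k = c := by
  rw [coeff_lX_zpow_mul, sub_self, h.coeff_zero]

lemma coeff_C_mul (c : ℂ) (L : ℂ⸨X⸩) (i : ℤ) : (HahnSeries.C c * L).coeff i = c * L.coeff i := by
  rw [HahnSeries.C_mul_eq_smul, HahnSeries.coeff_smul, smul_eq_mul]

/-! ### Rational functions and their expansions -/

/-- `f` is, off `S`, a linear combination of powers `(v - a) ^ k` with `a ∈ S`, and `L` is the
same linear combination of powers of `ξ - a`. -/
inductive Expands (S : Set ℂ) (ξ : ℂ⸨X⸩) : (ℂ → ℂ) → ℂ⸨X⸩ → Prop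
  | zpow (a : ℂ) (ha : a ∈ S) (k : ℤ) :
      Expands S ξ (fun v => (v - a) ^ k) ((ξ - HahnSeries.C a) ^ k)
  | add (f g : ℂ → ℂ) (L M : ℂ⸨X⸩) (hf : Expands S ξ f L) (hg : Expands S ξ g M) :
      Expands S ξ (fun v => f v + g v) (L + M)
  | smul (c : ℂ) (f : ℂ → ℂ) (L : ℂ⸨X⸩) (hf : Expands S ξ f L) :
      Expands S ξ (fun v => c * f v) (HahnSeries.C c * L)
  | congr (f g : ℂ → ℂ) (L : ℂ⸨X⸩) (hf : Expands S ξ f L) (h : ∀ v ∉ S, f v = g v) :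
      Expands S ξ g L

namespace Expands

variable {S : Set ℂ} {ξ : ℂ⸨X⸩} {f : ℂ → ℂ} {L : ℂ⸨X⸩}

lemma congr' {g : ℂ → ℂ} {M : ℂ⸨X⸩} (hf : Expands S ξ f L) (h : ∀ v ∉ S, f v = g v)
    (hL : L = M) : Expands S ξ g M := hL ▸ hf.congr _ _ _ h

lemma one {a : ℂ} (ha : a ∈ S) : Expands S ξ (fun _ => 1) 1 :=
  (zpow a ha 0).congr' (by simp) (by simp)

variable (hξ : ∀ a ∈ S, ξ - HahnSeries.C a ≠ 0)
include hξ

lemma zpow_mul_sub (a : ℂ) {b : ℂ} (hb : b ∈ S) (k : ℤ) :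
    Expands S ξ (fun v => (v - b) ^ k * (v - a)) ((ξ - HahnSeries.C b) ^ k * (ξ - HahnSeries.C a)) := by
  have h := (zpow (ξ := ξ) b hb (k + 1)).add _ _ _ _ ((zpow (ξ := ξ) b hb k).smul (b - a) _ _)
  refine h.congr' (fun v hv => ?_) ?_
  · rw [zpow_add_one₀ (sub_ne_zero.2 fun h : v = b => hv (h ▸ hb))]
    ring
  · rw [zpow_add_one₀ (hξ b hb), map_sub]
    ring

/-- Partial fractions: `v - b = (v - a) + (a - b)` moves the exponent of `v - b` by one in either
direction, starting from `k = 0`. The same identity for `ξ` keeps the function and its expansion in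
step. -/
lemma zpow_mul_inv {a b : ℂ} (ha : a ∈ S) (hb : b ∈ S) (k : ℤ) :
    Expands S ξ (fun v => (v - b) ^ k * (v - a)⁻¹)
      ((ξ - HahnSeries.C b) ^ k * (ξ - HahnSeries.C a)⁻¹) := by
  rcases eq_or_ne a b with rfl | hab
  · refine (zpow (ξ := ξ) a ha (k - 1)).congr' (fun v hv => ?_) ?_
    · rw [zpow_sub_one₀ (sub_ne_zero.2 fun h : v = a => hv (h ▸ ha))]
    · rw [zpow_sub_one₀ (hξ a ha)]
  have hab' : a - b ≠ 0 := sub_ne_zero.2 hab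
  have hC : (HahnSeries.C (a - b) : ℂ⸨X⸩) ≠ 0 := by
    rwa [Ne, map_eq_zero]
  have hne : ∀ {v c : ℂ}, v ∉ S → c ∈ S → v - c ≠ 0 := fun hv hc =>
    sub_ne_zero.2 fun h => hv (h ▸ hc)
  induction k using Int.induction_on with
  | zero => exact (zpow (ξ := ξ) a ha (-1)).congr' (by simp) (by simp)
  | succ k ih =>
    have h := (zpow (ξ := ξ) b hb k).add _ _ _ _ (ih.smul (a - b) _ _)
    refine h.congr' (fun v hv => ?_) ?_
    · have := hne hv ha
      rw [zpow_add_one₀ (hne hv hb)]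
      field_simp
      ring
    · have := hξ a ha
      rw [zpow_add_one₀ (hξ b hb), map_sub]
      field_simp
      ring
  | pred k ih =>
    have h := (ih.add _ _ _ _ ((zpow (ξ := ξ) b hb (-k - 1)).smul (-1) _ _)).smul (a - b)⁻¹ _ _
    refine h.congr' (fun v hv => ?_) ?_
    · have := hne hv ha
      have := hne hv hb
      rw [zpow_sub_one₀ (hne hv hb)]
      field_simp
      ring
    · have := hξ a ha
      have := hξ b hb
      rw [zpow_sub_one₀ (hξ b hb), map_inv₀, map_neg, map_one]
      rw [inv_mul_eq_iff_eq_mul₀ hC, map_sub]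
      field_simp
      ring

lemma mul_sub (a : ℂ) (hf : Expands S ξ f L) :
    Expands S ξ (fun v => f v * (v - a)) (L * (ξ - HahnSeries.C a)) := by
  induction hf with
  | zpow b hb k => exact zpow_mul_sub hξ a hb k
  | add f g L M hf hg ih₁ ih₂ =>
    exact (ih₁.add _ _ _ _ ih₂).congr' (fun v _ => by ring) (by ring)
  | smul c f L hf ih => exact (ih.smul c _ _).congr' (fun v _ => by ring) (by ring)
  | congr f g L hf h ih => exact ih.congr' (fun v hv => by rw [h v hv]) rfl

lemma mul_inv_sub {a : ℂ} (ha : a ∈ S) (hf : Expands S ξ f L) :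
    Expands S ξ (fun v => f v * (v - a)⁻¹) (L * (ξ - HahnSeries.C a)⁻¹) := by
  induction hf with
  | zpow b hb k => exact zpow_mul_inv hξ ha hb k
  | add f g L M hf hg ih₁ ih₂ =>
    exact (ih₁.add _ _ _ _ ih₂).congr' (fun v _ => by ring) (by ring)
  | smul c f L hf ih => exact (ih.smul c _ _).congr' (fun v _ => by ring) (by ring)
  | congr f g L hf h ih => exact ih.congr' (fun v hv => by rw [h v hv]) rfl

lemma mul_zpow_sub {a : ℂ} (ha : a ∈ S) (hf : Expands S ξ f L) (k : ℤ) :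
    Expands S ξ (fun v => f v * (v - a) ^ k) (L * (ξ - HahnSeries.C a) ^ k) := by
  have hne : ∀ {v : ℂ}, v ∉ S → v - a ≠ 0 := fun hv => sub_ne_zero.2 fun h => hv (h ▸ ha)
  induction k using Int.induction_on with
  | zero => simpa using hf
  | succ k ih =>
    refine (ih.mul_sub hξ a).congr' (fun v hv => ?_) ?_
    · rw [zpow_add_one₀ (hne hv), mul_assoc]
    · rw [zpow_add_one₀ (hξ a ha), mul_assoc]
  | pred k ih =>
    refine (ih.mul_inv_sub hξ ha).congr' (fun v hv => ?_) ?_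
    · rw [zpow_sub_one₀ (hne hv), mul_assoc]
    · rw [zpow_sub_one₀ (hξ a ha), mul_assoc]

/-- For `c ≠ 0` the factor is `-c (v - 1/c)`; for `c = 0` it is `1` and there is no pole. Stating
the condition through the roots of `1 - c z` covers both cases. -/
lemma mul_one_sub_zpow {c : ℂ} (hc : ∀ z, 1 - c * z = 0 → z ∈ S) (hf : Expands S ξ f L) (k : ℤ) :
    Expands S ξ (fun v => f v * (1 - c * v) ^ k) (L * (1 - HahnSeries.C c * ξ) ^ k) := by
  rcases eq_or_ne c 0 with rfl | h0
  · simpa using hf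
  have h := (hf.mul_zpow_sub hξ (hc c⁻¹ (by rw [mul_inv_cancel₀ h0, sub_self])) k).smul ((-c) ^ k) _ _
  have hC : (HahnSeries.C c : ℂ⸨X⸩) ≠ 0 := by rwa [Ne, map_eq_zero]
  refine h.congr' (fun v _ => ?_) ?_
  · rw [mul_left_comm, ← mul_zpow]
    congr 2
    field_simp
    ring
  · rw [map_zpow₀, mul_left_comm, ← mul_zpow]
    congr 2
    rw [map_neg, map_inv₀]
    field_simp
    ring

end Expands

/-- The contour integral of a rational function around the pole `0` is the residue there. -/
lemma Expands.oint_zero {γ : SimpleLoop} {S : Set ℂ} {f : ℂ → ℂ} {L : ℂ⸨X⸩} (h0 : γ.Encloses 0)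
    (hS : ∀ a ∈ S, a ≠ 0 → γ.Excludes a) (hf : Expands S lX f L) :
    γ.Integrable f ∧ γ.oint f = L.coeff (-1) := by
  have htr : ∀ v ∈ γ.trace, v ∉ S := fun v hv hvS => by
    rcases eq_or_ne v 0 with rfl | h
    · exact h0.1 hv
    · exact (hS v hvS h).1 hv
  induction hf with
  | zpow a ha k =>
    have hat : a ∉ γ.trace := fun h => htr a h ha
    refine ⟨SimpleLoop.integrable_of_continuousOn (SimpleLoop.continuousOn_sub_zpow hat k), ?_⟩
    rcases eq_or_ne a 0 with rfl | hne
    · rw [map_zero, sub_zero, lX_zpow, HahnSeries.coeff_single]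
      split_ifs with hk
      · rw [← hk]
        simpa [SimpleLoop.windingNumber] using h0.2
      · exact SimpleLoop.oint_sub_zpow hat fun h => hk h.symm
    -- A pole `a ≠ 0` lies outside the loop. Its power expands into a power series without residue,
    -- and the integral vanishes too, for `k = -1` by the winding number.
    · rw [((hasConst_lX_sub a).zpow (neg_ne_zero.2 hne) k).coeff_neg (by norm_num)]
      by_cases hk : k = -1
      · rw [hk]
        simpa [SimpleLoop.windingNumber] using (hS a ha hne).2
      · exact SimpleLoop.oint_sub_zpow hat hk
  | add f g L M _ _ ih₁ ih₂ =>
    exact ⟨ih₁.1.add ih₂.1, by rw [SimpleLoop.oint_add ih₁.1 ih₂.1, ih₁.2, ih₂.2]; rfl⟩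
  | smul c f L _ ih =>
    exact ⟨ih.1.const_mul c, by rw [SimpleLoop.oint_const_mul, ih.2, coeff_C_mul]⟩
  | congr f g L _ h ih =>
    exact ⟨SimpleLoop.integrable_congr (fun v hv => h v (htr v hv)) ih.1,
      by rw [← ih.2]; exact SimpleLoop.oint_congr fun v hv => (h v (htr v hv)).symm⟩

end

/-! ### The involution `(1 - v) / (1 - ν v)` and residues at `1`. -/

section

open scoped LaurentSeries

/-- The series `1 - c X`. -/
def lOne (c : ℂ) : ℂ⸨X⸩ := 1 - HahnSeries.C c * lX

lemma hasConst_lOne (c : ℂ) : HasConst (lOne c) 1 := by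
  have := HasConst.one.sub ((HasConst.C c).mul HasConst.X)
  rwa [mul_zero, sub_zero] at this

lemma lOne_ne_zero (c : ℂ) : lOne c ≠ 0 := (hasConst_lOne c).ne_zero one_ne_zero

/-- The expansion of the involution `(1 - v) / (1 - ν v)`. -/
def lZeta (ν : ℂ) : ℂ⸨X⸩ := lOne 1 * (lOne ν)⁻¹

lemma hasConst_lZeta (ν : ℂ) : HasConst (lZeta ν) 1 := by
  have := (hasConst_lOne 1).mul ((hasConst_lOne ν).inv one_ne_zero)
  rw [inv_one, mul_one] at this
  exact this

lemma lZeta_ne_zero (ν : ℂ) : lZeta ν ≠ 0 := (hasConst_lZeta ν).ne_zero one_ne_zero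

lemma lZeta_mul (ν : ℂ) : lZeta ν * lOne ν = 1 - lX := by
  rw [lZeta, inv_mul_cancel_right₀ (lOne_ne_zero ν), lOne, map_one, one_mul]

lemma one_sub_lZeta (ν : ℂ) : 1 - lZeta ν = HahnSeries.C (1 - ν) * lX * (lOne ν)⁻¹ := by
  rw [eq_mul_inv_iff_mul_eq₀ (lOne_ne_zero ν), sub_mul, lZeta_mul, lOne, map_sub, map_one]
  ring

lemma one_sub_mul_lZeta (ν : ℂ) :
    1 - HahnSeries.C ν * lZeta ν = HahnSeries.C (1 - ν) * (lOne ν)⁻¹ := by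
  rw [eq_mul_inv_iff_mul_eq₀ (lOne_ne_zero ν), sub_mul, mul_assoc, lZeta_mul, lOne, map_sub,
    map_one]
  ring

/-- The derivative of `(1 - v) / (1 - ν v)`. -/
def lZetaDeriv (ν : ℂ) : ℂ⸨X⸩ := HahnSeries.C (ν - 1) * (lOne ν) ^ (-2 : ℤ)

/-- A polynomial of degree at most `n`: in the local parameter at `1` this is why poles of higher
order have no residue. -/
lemma coeff_lOne_pow_of_lt (c : ℂ) (n : ℕ) {i : ℤ} (hi : n < i) : (lOne c ^ n).coeff i = 0 := by
  induction n generalizing i with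
  | zero => rw [pow_zero, HahnSeries.coeff_one, if_neg (by push_cast at hi; omega)]
  | succ n ih =>
    have h : lOne c ^ (n + 1) = lOne c ^ n - HahnSeries.C c * (lX ^ (1 : ℤ) * lOne c ^ n) := by
      rw [pow_succ]
      nth_rw 2 [lOne]
      rw [zpow_one]
      ring
    rw [h, HahnSeries.coeff_sub, coeff_C_mul, coeff_lX_zpow_mul, ih (by push_cast at hi; omega),
      ih (by push_cast at hi; omega), mul_zero, sub_zero]

lemma lZeta_sub_one_zpow_mul (ν : ℂ) (hν : ν ≠ 1) (k : ℤ) :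
    (lZeta ν - 1) ^ k * lZetaDeriv ν =
      HahnSeries.C ((ν - 1) ^ (k + 1)) * (lX ^ k * lOne ν ^ (-k - 2)) := by
  have h1 : lZeta ν - 1 = HahnSeries.C (ν - 1) * lX * (lOne ν)⁻¹ := by
    rw [← neg_sub, one_sub_lZeta, ← neg_sub ν 1, map_neg]
    ring
  have hC : (HahnSeries.C (ν - 1) : ℂ⸨X⸩) ≠ 0 := by rwa [Ne, map_eq_zero, sub_eq_zero]
  rw [h1, lZetaDeriv, mul_zpow, mul_zpow, inv_zpow', map_zpow₀, zpow_add_one₀ hC,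
    sub_eq_add_neg (-k) 2, zpow_add₀ (lOne_ne_zero ν)]
  ring

lemma lZeta_sub_ne_zero {ν : ℂ} (hν : ν ≠ 1) (a : ℂ) : lZeta ν - HahnSeries.C a ≠ 0 := by
  rcases eq_or_ne a 1 with rfl | ha
  · rw [map_one, ← neg_ne_zero, neg_sub, one_sub_lZeta]
    refine mul_ne_zero (mul_ne_zero ?_ lX_ne_zero) (inv_ne_zero (lOne_ne_zero ν))
    rwa [Ne, map_eq_zero, sub_eq_zero, eq_comm]
  · exact ((hasConst_lZeta ν).sub (HasConst.C a)).ne_zero (sub_ne_zero.2 ha.symm)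

/-- The contour integral of a rational function around the pole `1` is the residue there, which
is computed with the local parameter `z` in `v = (1 - z) / (1 - ν z)`. -/
lemma Expands.oint_one {γ : SimpleLoop} {S : Set ℂ} {f : ℂ → ℂ} {L : ℂ⸨X⸩} {ν : ℂ} (hν : ν ≠ 1)
    (h1 : γ.Encloses 1) (hS : ∀ a ∈ S, a ≠ 1 → γ.Excludes a) (hf : Expands S (lZeta ν) f L) :
    γ.Integrable f ∧ γ.oint f = (L * lZetaDeriv ν).coeff (-1) := by
  have htr : ∀ v ∈ γ.trace, v ∉ S := fun v hv hvS => by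
    rcases eq_or_ne v 1 with rfl | h
    · exact h1.1 hv
    · exact (hS v hvS h).1 hv
  induction hf with
  | zpow a ha k =>
    have hat : a ∉ γ.trace := fun h => htr a h ha
    refine ⟨SimpleLoop.integrable_of_continuousOn (SimpleLoop.continuousOn_sub_zpow hat k), ?_⟩
    rcases eq_or_ne a 1 with rfl | hne
    · rw [map_one, lZeta_sub_one_zpow_mul ν hν, coeff_C_mul, coeff_lX_zpow_mul]
      rcases lt_trichotomy k (-1) with hk | rfl | hk
      · rw [SimpleLoop.oint_sub_zpow hat hk.ne]
        -- The wanted index `-1 - k` is one above the degree `-k - 2` of this polynomial.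
        obtain ⟨n, hn⟩ : ∃ n : ℕ, -k - 2 = n := ⟨(-k - 2).toNat, by omega⟩
        rw [hn, zpow_natCast, coeff_lOne_pow_of_lt _ _ (by omega), mul_zero]
      · rw [sub_self, ((hasConst_lOne ν).zpow_one _).coeff_zero]
        simpa [SimpleLoop.windingNumber] using h1.2
      · rw [SimpleLoop.oint_sub_zpow hat hk.ne', ((hasConst_lOne ν).zpow_one _).coeff_neg (by omega),
          mul_zero]
    · have hc := ((((hasConst_lZeta ν).sub (HasConst.C a)).zpow (sub_ne_zero.2 hne.symm) k).mul
        ((HasConst.C (ν - 1)).mul ((hasConst_lOne ν).zpow_one (-2))))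
      rw [lZetaDeriv, hc.coeff_neg (by norm_num)]
      by_cases hk : k = -1
      · rw [hk]
        simpa [SimpleLoop.windingNumber] using (hS a ha hne).2
      · exact SimpleLoop.oint_sub_zpow hat hk
  | add f g L M _ _ ih₁ ih₂ =>
    exact ⟨ih₁.1.add ih₂.1, by
      rw [SimpleLoop.oint_add ih₁.1 ih₂.1, ih₁.2, ih₂.2, add_mul, HahnSeries.coeff_add]⟩
  | smul c f L _ ih =>
    exact ⟨ih.1.const_mul c, by rw [SimpleLoop.oint_const_mul, ih.2, mul_assoc, coeff_C_mul]⟩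
  | congr f g L _ h ih =>
    exact ⟨SimpleLoop.integrable_congr (fun v hv => h v (htr v hv)) ih.1,
      by rw [← ih.2]; exact SimpleLoop.oint_congr fun v hv => (h v (htr v hv)).symm⟩

/-- The expansion of `1 - p + p v`. -/
def lTheta (p : ℂ) : ℂ⸨X⸩ := HahnSeries.C (1 - p) + HahnSeries.C p * lX

/-- The expansion of `1 - p + p z` at `z = (1 - v) / (1 - ν v)`, where `ν = (μ - p) / (1 - p)`. -/
def lTau (μ ν : ℂ) : ℂ⸨X⸩ := lOne μ * (lOne ν)⁻¹

lemma hasConst_lTheta (p : ℂ) : HasConst (lTheta p) (1 - p) := by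
  have := (HasConst.C (1 - p)).add ((HasConst.C p).mul HasConst.X)
  rwa [mul_zero, add_zero] at this

lemma hasConst_lTau (μ ν : ℂ) : HasConst (lTau μ ν) 1 := by
  have := (hasConst_lOne μ).mul ((hasConst_lOne ν).inv one_ne_zero)
  rw [inv_one, mul_one] at this
  exact this

lemma lTau_ne_zero (μ ν : ℂ) : lTau μ ν ≠ 0 := (hasConst_lTau μ ν).ne_zero one_ne_zero

/-- The relations between the parameters `p`, `μ` and `ν`. -/
structure Params (p μ ν : ℂ) : Prop where
  rel : ν * (1 - p) = μ - p
  ne_one : ν ≠ 1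

/-- From `μ = ν (1 - p) + p`. Thus the involution turns the one-step factor `lTheta` of the
functions `psi` into the one-step factor `lTau` of the dual functions. -/
lemma Params.lTau_eq {p μ ν : ℂ} (h : Params p μ ν) :
    lTau μ ν = HahnSeries.C (1 - p) + HahnSeries.C p * lZeta ν := by
  rw [lTau, mul_inv_eq_iff_eq_mul₀ (lOne_ne_zero ν), add_mul, mul_assoc, lZeta_mul, lOne, lOne,
    show μ = ν * (1 - p) + p by rw [h.rel]; ring, map_add, map_mul]
  rw [map_sub, map_one]
  ring

end

section

open Function

/-! ### One update of the process -/

/-- The boundary condition at the labels `i`, `i + 1`, for a function `U` of configurations. -/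
def BoundaryAt (ν : ℂ) (i : ℤ) (U : (ℤ → ℤ) → ℂ) : Prop := ∀ (z : ℤ → ℤ) (Y : ℤ),
  U (update (update z i Y) (i + 1) Y) - U (update (update z i Y) (i + 1) (Y - 1)) =
    ν * (U (update (update z i (Y + 1)) (i + 1) Y) -
      U (update (update z i (Y + 1)) (i + 1) (Y - 1)))

/-- Composition with the map that moves the particle `k` to the site `v`. -/
def moveTo (k v : ℤ) : ((ℤ → ℤ) → ℂ) →ₗ[ℂ] ((ℤ → ℤ) → ℂ) :=
  LinearMap.funLeft ℂ ℂ fun z => update z k v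

lemma moveTo_apply (k v : ℤ) (U : (ℤ → ℤ) → ℂ) (z : ℤ → ℤ) :
    moveTo k v U z = U (update z k v) := rfl

lemma moveTo_moveTo (k v w : ℤ) (U : (ℤ → ℤ) → ℂ) : moveTo k v (moveTo k w U) = moveTo k w U := by
  ext z; simp [moveTo_apply]

lemma BoundaryAt.moveTo {ν : ℂ} {i k : ℤ} {U : (ℤ → ℤ) → ℂ} (h : BoundaryAt ν i U) (hk : i + 1 < k)
    (v : ℤ) : BoundaryAt ν i (moveTo k v U) := fun z Y => by
  have key : ∀ u w : ℤ, update (update (update z i u) (i + 1) w) k v =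
      update (update (update z k v) i u) (i + 1) w := fun u w => by
    rw [update_comm (by omega : i + 1 ≠ k), update_comm (by omega : i ≠ k)]
  simp only [moveTo_apply, key]
  exact h _ Y

lemma BoundaryAt.sub {ν : ℂ} {i : ℤ} {U V : (ℤ → ℤ) → ℂ} (hU : BoundaryAt ν i U)
    (hV : BoundaryAt ν i V) : BoundaryAt ν i (U - V) := fun z Y => by
  simp only [Pi.sub_apply]
  linear_combination hU z Y - hV z Y

/-- The expectation of a function after one update of the particles `c, …, c + d` of the
configuration `y`, on the event that the last of them jumps and on the event that it stays. The
particle `c` has an empty site in front of it. -/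
def stepExp (p μ : ℂ) (c : ℤ) (y : ℤ → ℤ) :
    ℕ → (((ℤ → ℤ) → ℂ) →ₗ[ℂ] ℂ) × (((ℤ → ℤ) → ℂ) →ₗ[ℂ] ℂ)
  | 0 => (p • (LinearMap.proj y ∘ₗ moveTo c (y c + 1)), (1 - p) • LinearMap.proj y)
  | d + 1 =>
    let J := (stepExp p μ c y d).1
    let S := (stepExp p μ c y d).2
    let M := moveTo (c + d + 1) (y (c + d + 1) + 1)
    if y (c + d) = y (c + d + 1) + 1 then (μ • (J ∘ₗ M), (1 - μ) • J + S)
    else (p • ((J + S) ∘ₗ M), (1 - p) • (J + S))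

section stepExp

variable {p μ ν : ℂ} {c : ℤ} {y : ℤ → ℤ}

lemma stepExp_zero_fst (U : (ℤ → ℤ) → ℂ) :
    (stepExp p μ c y 0).1 U = p * U (update y c (y c + 1)) := rfl

lemma stepExp_zero_snd (U : (ℤ → ℤ) → ℂ) : (stepExp p μ c y 0).2 U = (1 - p) * U y := rfl

lemma stepExp_succ_of_eq {d : ℕ} (h : y (c + d) = y (c + d + 1) + 1) (U : (ℤ → ℤ) → ℂ) :
    (stepExp p μ c y (d + 1)).1 U =
        μ * (stepExp p μ c y d).1 (moveTo (c + d + 1) (y (c + d + 1) + 1) U) ∧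
      (stepExp p μ c y (d + 1)).2 U =
        (1 - μ) * (stepExp p μ c y d).1 U + (stepExp p μ c y d).2 U := by
  constructor <;> simp only [stepExp, if_pos h] <;> rfl

lemma stepExp_succ_of_ne {d : ℕ} (h : y (c + d) ≠ y (c + d + 1) + 1) (U : (ℤ → ℤ) → ℂ) :
    (stepExp p μ c y (d + 1)).1 U =
        p * ((stepExp p μ c y d).1 (moveTo (c + d + 1) (y (c + d + 1) + 1) U) +
          (stepExp p μ c y d).2 (moveTo (c + d + 1) (y (c + d + 1) + 1) U)) ∧
      (stepExp p μ c y (d + 1)).2 U =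
        (1 - p) * ((stepExp p μ c y d).1 U + (stepExp p μ c y d).2 U) := by
  constructor <;> simp only [stepExp, if_neg h] <;> rfl

/-- Only the configurations in which the last particle has jumped, respectively stayed, and the
particles behind it are at their places, matter. -/
lemma stepExp_congr (d : ℕ) :
    (∀ U V : (ℤ → ℤ) → ℂ, (∀ z, (∀ j, c + d < j → z j = y j) → z (c + d) = y (c + d) + 1 → U z = V z) →
      (stepExp p μ c y d).1 U = (stepExp p μ c y d).1 V) ∧
    (∀ U V : (ℤ → ℤ) → ℂ, (∀ z, (∀ j, c + d < j → z j = y j) → z (c + d) = y (c + d) → U z = V z) →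
      (stepExp p μ c y d).2 U = (stepExp p μ c y d).2 V) := by
  induction d with
  | zero =>
    constructor <;> intro U V h
    · rw [stepExp_zero_fst, stepExp_zero_fst, h]
      · intro j hj
        rw [update_of_ne (by push_cast at hj; omega)]
      · simp
    · rw [stepExp_zero_snd, stepExp_zero_snd, h] <;> simp
  | succ d ih =>
    have h1 : ∀ U V : (ℤ → ℤ) → ℂ,
        (∀ z, (∀ j, c + (d + 1 : ℕ) < j → z j = y j) →
          z (c + (d + 1 : ℕ)) = y (c + (d + 1 : ℕ)) + 1 → U z = V z) →
        ∀ z, (∀ j, c + d < j → z j = y j) →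
          moveTo (c + d + 1) (y (c + d + 1) + 1) U z = moveTo (c + d + 1) (y (c + d + 1) + 1) V z := by
      intro U V h z hz
      refine h _ (fun j hj => ?_) ?_
      · push_cast at hj
        exact (update_of_ne (by omega) _ _).trans (hz j (by omega))
      · push_cast
        rw [← add_assoc]
        exact update_self _ _ _
    have h2 : ∀ U V : (ℤ → ℤ) → ℂ,
        (∀ z, (∀ j, c + (d + 1 : ℕ) < j → z j = y j) →
          z (c + (d + 1 : ℕ)) = y (c + (d + 1 : ℕ)) → U z = V z) →
        ∀ z, (∀ j, c + d < j → z j = y j) → U z = V z := fun U V h z hz =>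
      h _ (fun j hj => hz j (by push_cast at hj; omega)) (hz _ (by push_cast; omega))
    constructor <;> intro U V h
    · by_cases hy : y (c + d) = y (c + d + 1) + 1
      · rw [(stepExp_succ_of_eq hy U).1, (stepExp_succ_of_eq hy V).1,
          ih.1 _ _ fun z hz _ => h1 U V h z hz]
      · rw [(stepExp_succ_of_ne hy U).1, (stepExp_succ_of_ne hy V).1,
          ih.1 _ _ fun z hz _ => h1 U V h z hz, ih.2 _ _ fun z hz _ => h1 U V h z hz]
    · by_cases hy : y (c + d) = y (c + d + 1) + 1
      · rw [(stepExp_succ_of_eq hy U).2, (stepExp_succ_of_eq hy V).2,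
          ih.1 _ _ fun z hz _ => h2 U V h z hz, ih.2 _ _ fun z hz _ => h2 U V h z hz]
      · rw [(stepExp_succ_of_ne hy U).2, (stepExp_succ_of_ne hy V).2,
          ih.1 _ _ fun z hz _ => h2 U V h z hz, ih.2 _ _ fun z hz _ => h2 U V h z hz]

/-- The difference quotient in the position of the particle `k`. -/
def jumpDiff (k v : ℤ) (U : (ℤ → ℤ) → ℂ) : (ℤ → ℤ) → ℂ := moveTo k (v + 1) U - moveTo k v U

/-- This equation is what remains when the rule for a follower is equated with a free jump. Let `G`
be `V` with the particle in front moved forward. The boundary condition makes `V` equal to `ν G`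
where that particle stays, so the difference of `V` in its position is `(1 - ν) G`; the hypothesis
`ih` about that particle, divided by `1 - ν`, gives the claim. -/
lemma stepExp_jumpDiff_of_eq (hν : ν ≠ 1) {d : ℕ} (hy : y (c + d) = y (c + d + 1) + 1)
    (ih : ∀ U : (ℤ → ℤ) → ℂ, (∀ i, c ≤ i → i < c + d → BoundaryAt ν i U) →
      (μ - p) * (stepExp p μ c y d).1 (jumpDiff (c + d) (y (c + d)) U) =
        p * ν * (stepExp p μ c y d).2 (jumpDiff (c + d) (y (c + d)) U))
    {U : (ℤ → ℤ) → ℂ} (hU : ∀ i, c ≤ i → i < c + d + 1 → BoundaryAt ν i U) :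
    (μ - p) * (stepExp p μ c y d).1 (jumpDiff (c + d + 1) (y (c + d + 1)) U) =
      p * (stepExp p μ c y d).2 (jumpDiff (c + d + 1) (y (c + d + 1)) U) := by
  set V := jumpDiff (c + d + 1) (y (c + d + 1)) U with hV
  set G := moveTo (c + d) (y (c + d) + 1) V with hG
  have hbd : ∀ z, z (c + d) = y (c + d) → V z = ν * G z := by
    intro z hz
    -- With `Y = y (c + d)` the follower is compared at `Y - 1` and `Y`; the site `Y` is forbidden
    -- while the front particle stays there, so `U` is used beyond the physical configurations.
    have h := hU (c + d) (by omega) (by omega) z (y (c + d))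
    rw [← hz, update_eq_self, hz] at h
    rw [hV, hG, hV]
    simp only [jumpDiff, moveTo_apply, Pi.sub_apply, ← hy]
    rw [show y (c + d + 1) = y (c + d) - 1 by omega]
    exact h
  have hJ : (stepExp p μ c y d).1 V = (stepExp p μ c y d).1 G :=
    (stepExp_congr d).1 _ _ fun z _ hz => by rw [hG, moveTo_apply, ← hz, update_eq_self]
  have hS : (stepExp p μ c y d).2 V = ν * (stepExp p μ c y d).2 G := by
    rw [← smul_eq_mul, ← map_smul]
    exact (stepExp_congr d).2 _ _ fun z _ hz => by rw [hbd z hz]; rfl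
  have hdiff : jumpDiff (c + d) (y (c + d)) V = (1 - ν) • G := by
    ext z
    have h := hbd (update z (c + d) (y (c + d))) (by simp)
    have hGG : G (update z (c + d) (y (c + d))) = G z := by simp [hG, moveTo_apply]
    rw [hGG] at h
    simp only [jumpDiff, Pi.sub_apply, Pi.smul_apply, smul_eq_mul, ← hG]
    rw [moveTo_apply, h]
    ring
  have hVb : ∀ i, c ≤ i → i < c + d → BoundaryAt ν i V := fun i h1 h2 =>
    ((hU i h1 (by omega)).moveTo (by omega) _).sub ((hU i h1 (by omega)).moveTo (by omega) _)
  have h := ih V hVb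
  rw [hdiff, map_smul, map_smul, smul_eq_mul, smul_eq_mul] at h
  rw [hJ, hS]
  refine mul_left_cancel₀ (sub_ne_zero.2 hν.symm) ?_
  linear_combination h

/-- The invariant handed down a cluster. A particle with an empty site in front splits its weight as
`p : 1 - p`, and then it is the relation `ν (1 - p) = μ - p`. A follower inherits it from
`stepExp_jumpDiff_of_eq`. -/
lemma stepExp_jumpDiff (h : Params p μ ν) (d : ℕ) : ∀ U : (ℤ → ℤ) → ℂ,
    (∀ i, c ≤ i → i < c + d → BoundaryAt ν i U) →
      (μ - p) * (stepExp p μ c y d).1 (jumpDiff (c + d) (y (c + d)) U) =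
        p * ν * (stepExp p μ c y d).2 (jumpDiff (c + d) (y (c + d)) U) := by
  induction d with
  | zero =>
    intro U _
    rw [stepExp_zero_fst, stepExp_zero_snd, Nat.cast_zero, add_zero]
    simp only [jumpDiff, Pi.sub_apply, moveTo_apply, update_idem]
    linear_combination (-p * (U (update y c (y c + 1)) - U (update y c (y c)))) * h.rel
  | succ d ih =>
    intro U hU
    have hk : c + ((d + 1 : ℕ) : ℤ) = c + d + 1 := by push_cast; ring
    rw [hk] at hU ⊢
    have hmove : moveTo (c + d + 1) (y (c + d + 1) + 1) (jumpDiff (c + d + 1) (y (c + d + 1)) U) =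
        jumpDiff (c + d + 1) (y (c + d + 1)) U := by
      rw [jumpDiff, map_sub, moveTo_moveTo, moveTo_moveTo]
    by_cases hy : y (c + d) = y (c + d + 1) + 1
    · have hs := stepExp_jumpDiff_of_eq h.ne_one hy ih hU
      rw [(stepExp_succ_of_eq hy _).1, (stepExp_succ_of_eq hy _).2, hmove]
      linear_combination ν * hs +
        (stepExp p μ c y d).1 (jumpDiff (c + d + 1) (y (c + d + 1)) U) * (-μ) * h.rel
    · rw [(stepExp_succ_of_ne hy _).1, (stepExp_succ_of_ne hy _).2, hmove]
      linear_combination (-p * ((stepExp p μ c y d).1 (jumpDiff (c + d + 1) (y (c + d + 1)) U) +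
        (stepExp p μ c y d).2 (jumpDiff (c + d + 1) (y (c + d + 1)) U))) * h.rel

/-- One update of the process acts on functions that satisfy the boundary conditions like
independent jumps of all particles. -/
lemma stepExp_eq_free (h : Params p μ ν) {U : ℕ → (ℤ → ℤ) → ℂ}
    {D : ℕ} (hbd : ∀ d ≤ D, ∀ i : ℤ, c ≤ i → i < c + d → BoundaryAt ν i (U d))
    (hfree : ∀ d < D, ∀ z : ℤ → ℤ, U d z = (1 - p) * U (d + 1) z +
      p * U (d + 1) (update z (c + d + 1) (z (c + d + 1) + 1))) {d : ℕ} (hd : d ≤ D) :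
    (stepExp p μ c y d).1 (U d) + (stepExp p μ c y d).2 (U d) =
      (1 - p) * U 0 y + p * U 0 (update y c (y c + 1)) := by
  induction d with
  | zero =>
    rw [stepExp_zero_fst, stepExp_zero_snd]
    ring
  | succ d ih =>
    -- The particles are freed one at a time from the back: passing from `U (d + 1)` to `U d`
    -- carries out the free jump of the last one, so the total does not depend on `d`.
    rw [← ih (by omega)]
    set k := c + d + 1 with hk
    have hfun : ∀ z, (∀ j, c + d < j → z j = y j) →
        U d z = ((1 - p) • U (d + 1) + p • moveTo k (y k + 1) (U (d + 1))) z := fun z hz => by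
      rw [hfree d (by omega) z, ← hk, hz k (by omega)]
      rfl
    have hdiff : ∀ z, (∀ j, c + d < j → z j = y j) →
        (moveTo k (y k + 1) (U (d + 1)) - U (d + 1)) z = jumpDiff k (y k) (U (d + 1)) z := by
      intro z hz
      simp only [jumpDiff, Pi.sub_apply, moveTo_apply]
      rw [← hz k (by omega), update_eq_self]
    have hd1 := (stepExp_congr (p := p) (μ := μ) d).1 _ _ fun z hz _ => hdiff z hz
    have hd2 := (stepExp_congr (p := p) (μ := μ) d).2 _ _ fun z hz _ => hdiff z hz
    rw [(stepExp_congr d).1 _ _ fun z hz _ => hfun z hz,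
      (stepExp_congr d).2 _ _ fun z hz _ => hfun z hz]
    rw [map_sub] at hd1 hd2
    simp only [map_add, map_smul, smul_eq_mul]
    by_cases hy : y (c + d) = y (c + d + 1) + 1
    · rw [(stepExp_succ_of_eq hy _).1, (stepExp_succ_of_eq hy _).2]
      have hs := stepExp_jumpDiff_of_eq h.ne_one hy (stepExp_jumpDiff h d)
        (U := U (d + 1)) fun i h1 h2 => hbd (d + 1) hd i h1 (by push_cast; omega)
      rw [← hk] at hs ⊢
      rw [← hd1, ← hd2] at hs
      linear_combination hs
    · rw [(stepExp_succ_of_ne hy _).1, (stepExp_succ_of_ne hy _).2, ← hk]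
      ring

end stepExp

end

section

open Function

open scoped LaurentSeries

/-! ### The determinantal solution of the evolution equations -/

/-- The weight with which the particle `i`, started at `y`, is seen after `s` updates at the site
`x` on the level `n`. -/
def psi (p ν : ℂ) (s : ℕ) (i y n x : ℤ) : ℂ :=
  (lX ^ (y + i - n) * (lZeta ν ^ (n - i) * lTheta p ^ s)).coeff x

/-- The coordinates of the dual functions. -/
def dualRow (μ ν : ℂ) (t s : ℕ) (i y j : ℤ) : ℂ :=
  (lX ^ (-i) * (lZeta ν ^ (y + i) * lTau μ ν ^ ((s : ℤ) - t))).coeff (-j)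

variable {p μ ν : ℂ} {t : ℕ}

/-- Multiplication by `lX` raises the starting point `y` by one, so a factor `lTheta` is one free
jump. -/
lemma psi_succ (s : ℕ) (i y n x : ℤ) :
    psi p ν (s + 1) i y n x = (1 - p) * psi p ν s i y n x + p * psi p ν s i (y + 1) n x := by
  have h : lX ^ (y + i - n) * (lZeta ν ^ (n - i) * lTheta p ^ (s + 1)) =
      HahnSeries.C (1 - p) * (lX ^ (y + i - n) * (lZeta ν ^ (n - i) * lTheta p ^ s)) +
      HahnSeries.C p * (lX ^ (y + 1 + i - n) * (lZeta ν ^ (n - i) * lTheta p ^ s)) := by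
    rw [show y + 1 + i - n = y + i - n + 1 by ring, zpow_add_one₀ lX_ne_zero, pow_succ]
    nth_rw 2 [lTheta]
    ring
  rw [psi, h, HahnSeries.coeff_add, coeff_C_mul, coeff_C_mul, psi, psi]

/-- Here `lZeta` raises `y`, and `lTau` is the free jump by `Params.lTau_eq`. -/
lemma dualRow_succ (h : Params p μ ν) (s : ℕ) (i y j : ℤ) :
    dualRow μ ν t (s + 1) i y j =
      (1 - p) * dualRow μ ν t s i y j + p * dualRow μ ν t s i (y + 1) j := by
  have h : lX ^ (-i) * (lZeta ν ^ (y + i) * lTau μ ν ^ (((s + 1 : ℕ) : ℤ) - t)) =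
      HahnSeries.C (1 - p) * (lX ^ (-i) * (lZeta ν ^ (y + i) * lTau μ ν ^ ((s : ℤ) - t))) +
      HahnSeries.C p * (lX ^ (-i) * (lZeta ν ^ (y + 1 + i) * lTau μ ν ^ ((s : ℤ) - t))) := by
    rw [show y + 1 + i = y + i + 1 by ring, zpow_add_one₀ (lZeta_ne_zero ν),
      show ((s + 1 : ℕ) : ℤ) - t = s - t + 1 by push_cast; ring, zpow_add_one₀ (lTau_ne_zero μ ν)]
    nth_rw 2 [h.lTau_eq]
    ring
  rw [dualRow, h, HahnSeries.coeff_add, coeff_C_mul, coeff_C_mul, dualRow, dualRow]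

/-- Equivalent to `ζ (1 - ν X) = 1 - X` for the involution `ζ`. -/
lemma psi_boundary (s : ℕ) (i y n x : ℤ) :
    psi p ν s (i + 1) y n x - psi p ν s (i + 1) (y - 1) n x =
      -(psi p ν s i y n x - ν * psi p ν s i (y + 1) n x) := by
  have h : lX ^ (y + (i + 1) - n) * (lZeta ν ^ (n - (i + 1)) * lTheta p ^ s) -
      lX ^ (y - 1 + (i + 1) - n) * (lZeta ν ^ (n - (i + 1)) * lTheta p ^ s) =
      -(lX ^ (y + i - n) * (lZeta ν ^ (n - i) * lTheta p ^ s) -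
        HahnSeries.C ν * (lX ^ (y + 1 + i - n) * (lZeta ν ^ (n - i) * lTheta p ^ s))) := by
    rw [show y + (i + 1) - n = y + i - n + 1 by ring, show y - 1 + (i + 1) - n = y + i - n by ring,
      show y + 1 + i - n = y + i - n + 1 by ring, show n - i = n - (i + 1) + 1 by ring,
      zpow_add_one₀ lX_ne_zero, zpow_add_one₀ (lZeta_ne_zero ν)]
    have hz : lZeta ν * (1 - HahnSeries.C ν * lX) = 1 - lX := lZeta_mul ν
    linear_combination (lX ^ (y + i - n) * lZeta ν ^ (n - (i + 1)) * lTheta p ^ s) * hz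
  have := congrArg (fun L : ℂ⸨X⸩ => L.coeff x) h
  simp only [HahnSeries.coeff_sub, HahnSeries.coeff_neg, coeff_C_mul] at this
  exact this

/-- The relation behind `psi_boundary` with `X` and `ζ` exchanged, `X (1 - ν ζ) = 1 - ζ`. As both
kinds of entries obey the same recursion, it holds for whole rows. -/
lemma dualRow_boundary (s : ℕ) (i y j : ℤ) :
    dualRow μ ν t s (i + 1) y j - dualRow μ ν t s (i + 1) (y - 1) j =
      -(dualRow μ ν t s i y j - ν * dualRow μ ν t s i (y + 1) j) := by
  have h : lX ^ (-(i + 1)) * (lZeta ν ^ (y + (i + 1)) * lTau μ ν ^ ((s : ℤ) - t)) -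
      lX ^ (-(i + 1)) * (lZeta ν ^ (y - 1 + (i + 1)) * lTau μ ν ^ ((s : ℤ) - t)) =
      -(lX ^ (-i) * (lZeta ν ^ (y + i) * lTau μ ν ^ ((s : ℤ) - t)) -
        HahnSeries.C ν * (lX ^ (-i) * (lZeta ν ^ (y + 1 + i) * lTau μ ν ^ ((s : ℤ) - t)))) := by
    rw [show -i = -(i + 1) + 1 by ring, show y - 1 + (i + 1) = y + i by ring,
      show y + (i + 1) = y + i + 1 by ring, show y + 1 + i = y + i + 1 by ring,
      zpow_add_one₀ lX_ne_zero, zpow_add_one₀ (lZeta_ne_zero ν)]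
    have hz : lZeta ν - 1 = -(1 - HahnSeries.C ν * lZeta ν) * lX := by
      rw [one_sub_mul_lZeta, ← neg_sub, one_sub_lZeta]
      ring
    linear_combination (lX ^ (-(i + 1)) * lZeta ν ^ (y + i) * lTau μ ν ^ ((s : ℤ) - t)) * hz
  have := congrArg (fun L : ℂ⸨X⸩ => L.coeff (-j)) h
  simp only [HahnSeries.coeff_sub, HahnSeries.coeff_neg, coeff_C_mul] at this
  exact this

lemma psi_eq_zero {s : ℕ} {i y n x : ℤ} (h : x < y + i - n) : psi p ν s i y n x = 0 :=
  coeff_lX_zpow_mul_of_lt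
    (((hasConst_lZeta ν).zpow_one _).mul ((hasConst_lTheta p).pow s)) h

lemma psi_zero_self (i y x : ℤ) : psi p ν 0 i y i x = if x = y then 1 else 0 := by
  rw [psi, add_sub_cancel_right, sub_self, zpow_zero, pow_zero, mul_one, mul_one, lX_zpow,
    HahnSeries.coeff_single]
  split_ifs <;> rfl

lemma psi_zero_eq (p' : ℂ) (i y n x : ℤ) : psi p ν 0 i y n x = psi p' ν 0 i y n x := by
  simp only [psi, pow_zero]

lemma hasConst_dual (μ ν : ℂ) (k l : ℤ) : HasConst (lZeta ν ^ k * lTau μ ν ^ l) 1 := by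
  have := ((hasConst_lZeta ν).zpow_one k).mul ((hasConst_lTau μ ν).zpow_one l)
  rwa [mul_one] at this

lemma dualRow_eq_zero {s : ℕ} {i y j : ℤ} (h : i < j) : dualRow μ ν t s i y j = 0 :=
  coeff_lX_zpow_mul_of_lt (hasConst_dual μ ν _ _) (by omega)

lemma dualRow_self (s : ℕ) (i y : ℤ) : dualRow μ ν t s i y i = 1 :=
  coeff_lX_zpow_mul_self (hasConst_dual μ ν _ _) _

variable {m : ℕ} (p μ ν t) (n a : Fin m → ℤ) (C c N : ℤ)

/-- The points of the kernel at which the Fredholm determinant lives. -/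
def box : Finset (Fin m × ℤ) :=
  Finset.univ.biUnion fun k => {k} ×ˢ Finset.Ico (-C - n k) (a k)

variable {n a C} in
lemma mem_box {b : Fin m × ℤ} : b ∈ box n a C ↔ -C - n b.1 ≤ b.2 ∧ b.2 < a b.1 := by
  obtain ⟨k, x⟩ := b
  simp [box]

/-- The kernel `φ*`. -/
def phi (b b' : Fin m × ℤ) : ℂ :=
  if n b.1 < n b'.1 then psi 0 ν 0 (n b'.1) b'.2 (n b.1) b.2 else 0

/-- The rows of the particles in the bordered matrix. -/
def particleRow (s : ℕ) (i y : ℤ) : ↥(Finset.Icc c N) ⊕ ↥(box n a C) → ℂ :=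
  Sum.elim (fun j => dualRow μ ν t s i y j) fun b => psi p ν s i y (n b.1.1) b.1.2

/-- The rows of the points of the kernel in the bordered matrix. -/
def siteRow (b : Fin m × ℤ) : ↥(Finset.Icc c N) ⊕ ↥(box n a C) → ℂ :=
  Sum.elim (fun j => dualRow μ ν t 0 (n b.1) b.2 j)
    fun b' => phi ν n b' b + if b'.1 = b then 1 else 0

/-- The bordered matrix for the configuration `y`, where the particle `i` has `σ i` updates left. -/
def bordered (σ : ℤ → ℕ) (y : ℤ → ℤ) : Matrix (↥(Finset.Icc c N) ⊕ ↥(box n a C))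
    (↥(Finset.Icc c N) ⊕ ↥(box n a C)) ℂ :=
  Matrix.of (Sum.elim (fun i => particleRow p μ ν t n a C c N (σ i) i (y i))
    fun b => siteRow μ ν t n a C c N b)

/-- The determinantal solution. -/
def detSol (σ : ℤ → ℕ) (y : ℤ → ℤ) : ℂ := (bordered p μ ν t n a C c N σ y).det

variable {p μ ν t n a C c N}

lemma bordered_inl (σ : ℤ → ℕ) (y : ℤ → ℤ) (i : ↥(Finset.Icc c N)) :
    bordered p μ ν t n a C c N σ y (Sum.inl i) = particleRow p μ ν t n a C c N (σ i) i (y i) := rfl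

lemma bordered_inr (σ : ℤ → ℕ) (y : ℤ → ℤ) (b : ↥(box n a C)) :
    bordered p μ ν t n a C c N σ y (Sum.inr b) = siteRow μ ν t n a C c N b := rfl

lemma bordered_update (σ : ℤ → ℕ) (y : ℤ → ℤ) {i : ℤ} (hi : i ∈ Finset.Icc c N) (v : ℤ) :
    bordered p μ ν t n a C c N σ (update y i v) = (bordered p μ ν t n a C c N σ y).updateRow
      (Sum.inl ⟨i, hi⟩) (particleRow p μ ν t n a C c N (σ i) i v) := by
  ext r s
  rw [Matrix.updateRow_apply]
  rcases r with ⟨j, hj⟩ | b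
  · by_cases h : j = i
    · subst h
      rw [if_pos rfl, bordered_inl, update_self]
    · rw [if_neg (by simpa using h), bordered_inl, bordered_inl, update_of_ne h]
  · rw [if_neg (by simp), bordered_inr, bordered_inr]

lemma bordered_update_time (σ : ℤ → ℕ) (y : ℤ → ℤ) {i : ℤ} (hi : i ∈ Finset.Icc c N) (s : ℕ) :
    bordered p μ ν t n a C c N (update σ i s) y = (bordered p μ ν t n a C c N σ y).updateRow
      (Sum.inl ⟨i, hi⟩) (particleRow p μ ν t n a C c N s i (y i)) := by
  ext r s
  rw [Matrix.updateRow_apply]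
  rcases r with ⟨j, hj⟩ | b
  · by_cases h : j = i
    · subst h
      rw [if_pos rfl, bordered_inl, update_self]
    · rw [if_neg (by simpa using h), bordered_inl, bordered_inl, update_of_ne h]
  · rw [if_neg (by simp), bordered_inr, bordered_inr]

lemma particleRow_succ (h : Params p μ ν) (s : ℕ) (i y : ℤ) :
    particleRow p μ ν t n a C c N (s + 1) i y = (1 - p) • particleRow p μ ν t n a C c N s i y +
      p • particleRow p μ ν t n a C c N s i (y + 1) := by
  funext r
  rcases r with j | b
  · exact dualRow_succ h s i y j
  · exact psi_succ s i y _ _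

lemma particleRow_boundary (s : ℕ) (i y : ℤ) :
    particleRow p μ ν t n a C c N s (i + 1) y - particleRow p μ ν t n a C c N s (i + 1) (y - 1) =
      -(particleRow p μ ν t n a C c N s i y - ν • particleRow p μ ν t n a C c N s i (y + 1)) := by
  funext r
  rcases r with j | b
  · exact dualRow_boundary s i y j
  · exact psi_boundary s i y _ _

lemma detSol_update_time (h : Params p μ ν) (σ : ℤ → ℕ) (y : ℤ → ℤ) {i : ℤ}
    (hi : i ∈ Finset.Icc c N) :
    detSol p μ ν t n a C c N (update σ i (σ i + 1)) y =
      (1 - p) * detSol p μ ν t n a C c N σ y +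
        p * detSol p μ ν t n a C c N σ (update y i (y i + 1)) := by
  rw [detSol, detSol, detSol, bordered_update_time σ y hi, bordered_update σ y hi,
    particleRow_succ h, Matrix.det_updateRow_add, Matrix.det_updateRow_smul,
    Matrix.det_updateRow_smul]
  congr 3
  have := bordered_update (p := p) (μ := μ) (ν := ν) (t := t) (n := n) (a := a) (C := C) σ y hi (y i)
  rw [update_eq_self] at this
  exact this.symm

lemma _root_.Matrix.det_updateRow_updateRow_swap {ι : Type*} [Fintype ι] [DecidableEq ι]
    (M : Matrix ι ι ℂ) {i j : ι} (hij : i ≠ j) (u v : ι → ℂ) :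
    ((M.updateRow i u).updateRow j v).det = -((M.updateRow i v).updateRow j u).det := by
  have hz : ∀ w : ι → ℂ, ((M.updateRow i w).updateRow j w).det = 0 := fun w =>
    Matrix.det_zero_of_row_eq hij (by rw [Matrix.updateRow_ne hij, Matrix.updateRow_self,
      Matrix.updateRow_self])
  have h := hz (u + v)
  rw [Matrix.det_updateRow_add, Matrix.updateRow_comm _ hij, Matrix.det_updateRow_add,
    Matrix.updateRow_comm _ hij (u + v) v, Matrix.det_updateRow_add,
    Matrix.updateRow_comm _ hij.symm, Matrix.updateRow_comm _ hij.symm,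
    Matrix.updateRow_comm _ hij.symm, Matrix.updateRow_comm _ hij.symm, hz, hz] at h
  linear_combination h

/-- Write `u` for the row of the particle `i` as a function of its position. The row relation
replaces the difference in row `i + 1` by `-u Y + ν u (Y + 1)`. Beside `u Y` the first term drops
out, beside `u (Y + 1)` the second, and the two surviving determinants differ by an exchange of
rows. This requires equal remaining times for both particles. -/
lemma detSol_boundaryAt (σ : ℤ → ℕ) {i : ℤ} (hi : i ∈ Finset.Icc c N)
    (hi' : i + 1 ∈ Finset.Icc c N) (hσ : σ (i + 1) = σ i) :
    BoundaryAt ν i (detSol p μ ν t n a C c N σ) := by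
  intro z Y
  have hne : (Sum.inl ⟨i, hi⟩ : ↥(Finset.Icc c N) ⊕ ↥(box n a C)) ≠ Sum.inl ⟨i + 1, hi'⟩ := by simp
  simp only [detSol, bordered_update _ _ hi', bordered_update _ _ hi, hσ]
  set M := bordered p μ ν t n a C c N σ z
  have key : ∀ u : ↥(Finset.Icc c N) ⊕ ↥(box n a C) → ℂ,
      ((M.updateRow (Sum.inl ⟨i, hi⟩) u).updateRow (Sum.inl ⟨i + 1, hi'⟩)
        (particleRow p μ ν t n a C c N (σ i) (i + 1) Y)).det -
      ((M.updateRow (Sum.inl ⟨i, hi⟩) u).updateRow (Sum.inl ⟨i + 1, hi'⟩)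
        (particleRow p μ ν t n a C c N (σ i) (i + 1) (Y - 1))).det =
      -((M.updateRow (Sum.inl ⟨i, hi⟩) u).updateRow (Sum.inl ⟨i + 1, hi'⟩)
        (particleRow p μ ν t n a C c N (σ i) i Y)).det +
      ν * ((M.updateRow (Sum.inl ⟨i, hi⟩) u).updateRow (Sum.inl ⟨i + 1, hi'⟩)
        (particleRow p μ ν t n a C c N (σ i) i (Y + 1))).det := by
    intro u
    have h := particleRow_boundary (p := p) (μ := μ) (ν := ν) (t := t) (n := n) (a := a) (C := C)
      (c := c) (N := N) (σ i) i Y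
    rw [sub_eq_iff_eq_add] at h
    rw [h, Matrix.det_updateRow_add, neg_sub, sub_eq_add_neg (ν • _), Matrix.det_updateRow_add,
      Matrix.det_updateRow_smul, ← neg_one_smul ℂ (particleRow _ _ _ _ _ _ _ _ _ _ _ _),
      Matrix.det_updateRow_smul]
    ring
  have hz : ∀ w : ↥(Finset.Icc c N) ⊕ ↥(box n a C) → ℂ,
      ((M.updateRow (Sum.inl ⟨i, hi⟩) w).updateRow (Sum.inl ⟨i + 1, hi'⟩) w).det = 0 := fun w =>
    Matrix.det_zero_of_row_eq hne (by rw [Matrix.updateRow_ne hne, Matrix.updateRow_self,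
      Matrix.updateRow_self])
  rw [key, key, hz, hz, Matrix.det_updateRow_updateRow_swap M hne]
  ring

end

/-! ### The two ends of the evolution, and changes of the window. -/

section

open Function

/-- Block triangular with identity blocks on the diagonal. Indices may share a degree, as the box
points over one label do. -/
lemma _root_.Matrix.det_eq_one_of_deg {ι : Type*} [Fintype ι] [DecidableEq ι]
    (M : Matrix ι ι ℂ) (deg : ι → ℤ) (h0 : ∀ r s, deg r < deg s → M r s = 0)
    (h1 : ∀ r s, deg r = deg s → M r s = if r = s then 1 else 0) : M.det = 1 := by
  have ht : M.BlockTriangular fun r => -deg r := fun r s h => h0 r s (by simpa using h)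
  rw [ht.det]
  refine Finset.prod_eq_one fun d _ => ?_
  have : M.toSquareBlock (fun r => -deg r) d = 1 := by
    ext ⟨r, hr⟩ ⟨s, hs⟩
    rw [Matrix.toSquareBlock_def, Matrix.of_apply, h1 r s (by omega),
      Matrix.one_apply]
    simp
  rw [this, Matrix.det_one]

variable {p μ ν : ℂ} {t : ℕ} {m : ℕ} {n a : Fin m → ℤ} {C c N : ℤ}

lemma add_le_of_strictAnti {y : ℤ → ℤ} (hy : ∀ i, c ≤ i → i < N → y (i + 1) < y i) {i j : ℤ}
    (hi : c ≤ i) (hij : i ≤ j) (hj : j ≤ N) : y j + (j - i) ≤ y i := by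
  induction j, hij using Int.leInduction with
  | base => simp
  | succ j hij ih =>
    have := hy j (by omega) (by omega)
    have := ih (by omega)
    omega

/-- The initial values of the determinantal solution. -/
lemma detSol_zero (hn : Injective n) (hnc : ∀ k, n k ∈ Finset.Icc c N) {y : ℤ → ℤ}
    (hy : ∀ i, c ≤ i → i < N → y (i + 1) < y i) (hC : ∀ k, -C - n k ≤ y (n k)) :
    detSol p μ ν t n a C c N (fun _ => 0) y = if ∀ k, a k ≤ y (n k) then 1 else 0 := by
  have hpsi : ∀ k, a k ≤ y (n k) → ∀ i, c ≤ i → i ≤ n k → ∀ x < a k,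
      psi p ν 0 i (y i) (n k) x = 0 := fun k hk i hi hik x hx =>
    psi_eq_zero (by
      have := add_le_of_strictAnti hy hi hik (Finset.mem_Icc.1 (hnc k)).2
      omega)
  split_ifs with h
  -- The points over the label `n k` are placed just after the particle `n k`, at the odd degree. On
  -- them the `psi` entries of all particles up to `n k` vanish, since `y i + i` decreases weakly in
  -- `i` and `a k ≤ y (n k)`.
  · refine Matrix.det_eq_one_of_deg _ (Sum.elim (fun i => 2 * i.1) fun b => 2 * n b.1.1 + 1) ?_ ?_
    · rintro (i | b) (j | b') hlt <;> simp only [Sum.elim_inl, Sum.elim_inr] at hlt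
      · exact dualRow_eq_zero (by omega)
      · exact hpsi _ (h _) _ (Finset.mem_Icc.1 i.2).1 (by omega) _ (mem_box.1 b'.2).2
      · exact dualRow_eq_zero (by omega)
      · have h1 : ¬ n b'.1.1 < n b.1.1 := by omega
        have h2 : b' ≠ b := fun h => by rw [h] at hlt; omega
        simp [bordered, siteRow, phi, h1, h2]
    · rintro (i | b) (j | b') heq <;> simp only [Sum.elim_inl, Sum.elim_inr] at heq
      · have : i = j := Subtype.ext (by omega)
        subst this
        rw [if_pos rfl]
        exact dualRow_self _ _ _
      · omega
      · omega
      · have h1 : ¬ n b'.1.1 < n b.1.1 := by omega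
        simp [bordered, siteRow, phi, h1, eq_comm]
  · push Not at h
    -- With the largest offending label, all selected particles behind it have reached their
    -- thresholds. Over their labels the `psi` entries of this row vanish, as do those of `phi` in
    -- the row of the point.
    obtain ⟨k, hk, hmax⟩ := (Finset.univ.filter fun k => y (n k) < a k).exists_max_image n
      (by obtain ⟨k, hk⟩ := h; exact ⟨k, by simpa using hk⟩)
    rw [Finset.mem_filter] at hk
    have hb : (k, y (n k)) ∈ box n a C := mem_box.2 ⟨hC k, hk.2⟩
    refine Matrix.det_zero_of_row_eq (i := Sum.inl ⟨n k, hnc k⟩) (j := Sum.inr ⟨_, hb⟩)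
      (by simp) (funext fun r => ?_)
    rcases r with j | ⟨⟨k', x⟩, hb'⟩
    · rfl
    · have hx := (mem_box.1 hb').2
      simp only [bordered, siteRow, particleRow, phi, Matrix.of_apply, Sum.elim_inl, Sum.elim_inr,
        Prod.mk.injEq]
      rcases lt_trichotomy (n k') (n k) with hlt | heq | hgt
      · have hne : k' ≠ k := fun h => by rw [h] at hlt; omega
        rw [if_pos hlt, if_neg (by simp [hne]), add_zero, psi_zero_eq 0]
      · have hkk := hn heq
        subst hkk
        simp [psi_zero_self]
      · have hne : k' ≠ k := fun h => by rw [h] at hgt; omega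
        rw [if_neg (by omega), if_neg (by simp [hne]), add_zero]
        refine hpsi k' ?_ _ (Finset.mem_Icc.1 (hnc k)).1 hgt.le _ hx
        by_contra hlt
        have := hmax k' (by simpa using hlt)
        omega

/-- Particles that are far to the right do not matter. -/
lemma detSol_window {c' : ℤ} (hc : c' ≤ c) (σ : ℤ → ℕ) {y : ℤ → ℤ}
    (hy : ∀ i, c' ≤ i → i < c → ∀ k, a k + n k ≤ y i + i) :
    detSol p μ ν t n a C c' N σ y = detSol p μ ν t n a C c N σ y := by
  have hpsi : ∀ i, c' ≤ i → i < c → ∀ b : ↥(box n a C),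
      psi p ν (σ i) i (y i) (n b.1.1) b.1.2 = 0 := fun i h1 h2 b => psi_eq_zero (by
    have := hy i h1 h2 b.1.1
    have := (mem_box.1 b.2).2
    omega)
  -- `q` marks what is kept. The removed rows vanish in the kept columns and form a unitriangular
  -- block.
  let q : ↥(Finset.Icc c' N) ⊕ ↥(box n a C) → Prop := Sum.elim (fun i => c ≤ i.1) fun _ => True
  have : DecidablePred q := Classical.decPred q
  rw [detSol, Matrix.twoBlockTriangular_det _ q]
  · have h1 : (Matrix.toSquareBlockProp (bordered p μ ν t n a C c' N σ y) fun r => ¬ q r).det = 1 := by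
      refine Matrix.det_eq_one_of_deg _
        (fun r => Sum.elim (fun i : ↥(Finset.Icc c' N) => i.1) (fun _ => 0) r.1) ?_ ?_
      · rintro ⟨i | b, hi⟩ ⟨j | b', hj⟩ hlt
        · exact dualRow_eq_zero hlt
        · simp [q] at hj
        · simp [q] at hi
        · simp [q] at hi
      · rintro ⟨i | b, hi⟩ ⟨j | b', hj⟩ heq
        · have : i = j := Subtype.ext heq
          subst this
          rw [if_pos rfl]
          exact dualRow_self _ _ _
        · simp [q] at hj
        · simp [q] at hi
        · simp [q] at hi
    rw [h1, mul_one]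
    let f : ↥(Finset.Icc c N) ⊕ ↥(box n a C) → {r // q r} := Sum.elim
      (fun i => ⟨Sum.inl ⟨i.1, Finset.Icc_subset_Icc_left hc i.2⟩, (Finset.mem_Icc.1 i.2).1⟩)
      fun b => ⟨Sum.inr b, trivial⟩
    have hf : Bijective f := by
      constructor
      · rintro (i | b) (j | b') h
        · have := congrArg (fun r : {r // q r} => r.1) h
          simp only [f, Sum.elim_inl, Sum.inl.injEq, Subtype.mk.injEq] at this
          rw [Subtype.ext this]
        · have := congrArg (fun r : {r // q r} => r.1) h
          simp [f] at this
        · have := congrArg (fun r : {r // q r} => r.1) h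
          simp [f] at this
        · have := congrArg (fun r : {r // q r} => r.1) h
          simp only [f, Sum.elim_inr, Sum.inr.injEq] at this
          rw [this]
      · rintro ⟨i | b, h⟩
        · exact ⟨Sum.inl ⟨i.1, Finset.mem_Icc.2 ⟨h, (Finset.mem_Icc.1 i.2).2⟩⟩, rfl⟩
        · exact ⟨Sum.inr b, rfl⟩
    rw [← Matrix.det_submatrix_equiv_self (Equiv.ofBijective f hf), detSol]
    congr 1
    ext (i | b) (j | b') <;> rfl
  · rintro (i | b) hi (j | b') hj
    · exact dualRow_eq_zero (lt_of_lt_of_le (not_le.1 hi) hj)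
    · exact hpsi _ (Finset.mem_Icc.1 i.2).1 (not_le.1 hi) b'
    · simp [q] at hi
    · simp [q] at hi

/-- The matrix of the dual functions of the initial configuration. -/
def dualMatrix (μ ν : ℂ) (t : ℕ) (c N : ℤ) (y : ℤ → ℤ) :
    Matrix ↥(Finset.Icc c N) ↥(Finset.Icc c N) ℂ :=
  Matrix.of fun i j => dualRow μ ν t t i (y i) j

lemma det_dualMatrix (y : ℤ → ℤ) : (dualMatrix μ ν t c N y).det = 1 := by
  refine Matrix.det_eq_one_of_deg _ (fun i => i.1) (fun i j h => dualRow_eq_zero h) fun i j h => ?_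
  have : i = j := Subtype.ext h
  subst this
  rw [if_pos rfl]
  exact dualRow_self _ _ _

/-- The determinantal solution as a determinant over the points of the kernel. -/
lemma detSol_eq_det_one_sub {y : ℤ → ℤ} {K : Fin m × ℤ → Fin m × ℤ → ℂ}
    (Φ : Matrix ↥(box n a C) ↥(Finset.Icc c N) ℂ)
    (hΦ : ∀ b (j : ↥(Finset.Icc c N)), ∑ i, Φ b i * dualRow μ ν t t i.1 (y i.1) j =
      dualRow μ ν t 0 (n b.1.1) b.1.2 j)
    (hK : ∀ b ∈ box n a C, ∀ b' : ↥(box n a C), K b b' = -phi ν n b b' +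
      ∑ i : ↥(Finset.Icc c N), psi p ν t i.1 (y i.1) (n b.1) b.2 * Φ b' i) :
    detSol p μ ν t n a C c N (fun _ => t) y =
      (1 - Matrix.of fun b b' : ↥(box n a C) => K b b').det := by
  set Ψ : Matrix ↥(Finset.Icc c N) ↥(box n a C) ℂ :=
    Matrix.of fun i b => psi p ν t i.1 (y i.1) (n b.1.1) b.1.2
  -- `Φ` clears the dual entries of the site rows; the Schur complement left in the corner is the
  -- transpose of `1 - K`.
  have hfac : bordered p μ ν t n a C c N (fun _ => t) y =
      Matrix.fromBlocks 1 0 Φ 1 * Matrix.fromBlocks (dualMatrix μ ν t c N y) Ψ 0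
        (1 - Matrix.of fun b b' : ↥(box n a C) => K b b').transpose := by
    rw [Matrix.fromBlocks_multiply]
    ext (i | b) (j | b')
    · simp [bordered, particleRow, dualMatrix]
    · simp [bordered, particleRow, Ψ]
    · have := (hΦ b j).symm
      simpa [bordered, siteRow, dualMatrix, Matrix.mul_apply] using this
    · have := hK b' b'.2 b
      simp only [bordered, siteRow, Ψ, Matrix.mul_apply, Matrix.of_apply, Sum.elim_inr,
        Matrix.fromBlocks_apply₂₂, Matrix.add_apply, Matrix.one_mul, Matrix.transpose_apply,
        Matrix.sub_apply, this, Matrix.one_apply, Subtype.coe_inj, mul_comm (Φ b _)]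
      ring
  rw [detSol, hfac, Matrix.det_mul, Matrix.det_fromBlocks_zero₁₂, Matrix.det_fromBlocks_zero₂₁,
    det_dualMatrix, Matrix.det_transpose]
  simp

/-- The dual rows of any configuration form a unitriangular matrix, so the coordinates exist without
a closed form. Alternating initial data use them in this way. -/
lemma exists_dual_coords (y : ℤ → ℤ) (n a : Fin m → ℤ) (C : ℤ) :
    ∃ Φ : Matrix ↥(box n a C) ↥(Finset.Icc c N) ℂ, ∀ b (j : ↥(Finset.Icc c N)),
      ∑ i, Φ b i * dualRow μ ν t t i.1 (y i.1) j = dualRow μ ν t 0 (n b.1.1) b.1.2 j := by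
  let B : Matrix ↥(box n a C) ↥(Finset.Icc c N) ℂ :=
    Matrix.of fun b j => dualRow μ ν t 0 (n b.1.1) b.1.2 j
  refine ⟨B * (dualMatrix μ ν t c N y)⁻¹, fun b j => ?_⟩
  have h : B * (dualMatrix μ ν t c N y)⁻¹ * dualMatrix μ ν t c N y = B :=
    Matrix.nonsing_inv_mul_cancel_right _ _ (by rw [det_dualMatrix]; exact isUnit_one)
  exact congrFun (congrFun h b) j

end

section

open Function

/-! ### Fredholm determinants of finitely supported kernels -/

lemma fredholmMinor_eq_zero_of_not_injective {ι : Type*} (K : ι → ι → ℂ) {k : ℕ} {z : Fin k → ι}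
    (hz : ¬ Injective z) : fredholmMinor K k z = 0 := by
  rw [Injective] at hz
  push Not at hz
  obtain ⟨i, j, h, hij⟩ := hz
  exact Matrix.det_zero_of_row_eq hij (funext fun s => by simp [h])

/-- A tuple with a repetition contributes zero. The other tuples list each `k`-subset in `k!`
orders, and a principal minor does not depend on the order. -/
lemma sum_fredholmMinor {α : Type*} [Fintype α] [DecidableEq α] (M : Matrix α α ℂ) (k : ℕ) :
    ∑ z : Fin k → α, fredholmMinor M k z = (k.factorial : ℂ) * ∑ s ∈ Finset.univ.powersetCard k,
      (M.submatrix (Subtype.val : ↥s → α) (Subtype.val : ↥s → α)).det := by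
  classical
  rw [← Finset.sum_fiberwise Finset.univ (fun z : Fin k → α => Finset.univ.image z), Finset.mul_sum,
    ← Finset.sum_subset (Finset.subset_univ (Finset.univ.powersetCard k))]
  · refine Finset.sum_congr rfl fun s hs => ?_
    have hcard : s.card = k := (Finset.mem_powersetCard.1 hs).2
    have hk : Fintype.card (Fin k) = Fintype.card ↥s := by simp [hcard]
    have h : ∑ e : Fin k ≃ ↥s, fredholmMinor M k (fun l => (e l : α)) =
        ∑ z : Fin k → α with Finset.univ.image z = s, fredholmMinor M k z := by
      refine Finset.sum_bij (fun e _ l => (e l : α)) (fun e _ => ?_) (fun e _ e' _ h => ?_)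
        (fun z hz => ?_) fun e _ => rfl
      · rw [Finset.mem_filter]
        refine ⟨Finset.mem_univ _, Finset.ext fun x => ?_⟩
        simp only [Finset.mem_image, Finset.mem_univ, true_and]
        exact ⟨fun ⟨l, hl⟩ => hl ▸ (e l).2, fun hx => ⟨e.symm ⟨x, hx⟩, by simp⟩⟩
      · exact Equiv.ext fun l => Subtype.ext (congrFun h l)
      · have hz := (Finset.mem_filter.1 hz).2
        have hmem : ∀ l, z l ∈ s := fun l => hz ▸ Finset.mem_image_of_mem z (Finset.mem_univ l)
        have hsurj : Surjective fun l => (⟨z l, hmem l⟩ : ↥s) := by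
          rintro ⟨x, hx⟩
          rw [← hz, Finset.mem_image] at hx
          obtain ⟨l, -, hl⟩ := hx
          exact ⟨l, Subtype.ext hl⟩
        exact ⟨Equiv.ofBijective _ ((Fintype.bijective_iff_surjective_and_card _).2 ⟨hsurj, hk⟩),
          Finset.mem_univ _, rfl⟩
    rw [← h, Finset.sum_congr rfl fun e _ => ?_, Finset.sum_const, Finset.card_univ,
      Fintype.card_equiv (Fintype.equivOfCardEq hk), Fintype.card_fin, nsmul_eq_mul]
    rw [← Matrix.det_submatrix_equiv_self e]
    rfl
  · intro s _ hs
    refine Finset.sum_eq_zero fun z hz => fredholmMinor_eq_zero_of_not_injective _ fun hinj => hs ?_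
    rw [Finset.mem_powersetCard, ← (Finset.mem_filter.1 hz).2, Finset.card_image_of_injective _ hinj]
    simp

/-- The determinant `det (1 - M)` is its Fredholm series. -/
lemma det_one_sub_eq_sum {α : Type*} [Fintype α] [DecidableEq α] (M : Matrix α α ℂ) {d : ℕ}
    (hd : Fintype.card α < d) : (1 - M).det =
      ∑ k ∈ Finset.range d, (-1) ^ k / (k.factorial : ℂ) * ∑ z : Fin k → α, fredholmMinor M k z := by
  -- The coefficients of `det (1 - X M)` are signed sums of principal minors, and `X = 1` gives the
  -- determinant.
  set q : Polynomial ℂ := (1 + (Polynomial.X : Polynomial ℂ) • (-M).map Polynomial.C).det with hq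
  have hcoeff : ∀ k, q.coeff k = (-1) ^ k / (k.factorial : ℂ) *
      ∑ z : Fin k → α, fredholmMinor M k z := fun k => by
    have hk : (k.factorial : ℂ) ≠ 0 := by exact_mod_cast k.factorial_ne_zero
    rw [hq, Matrix.coeff_det_one_add_X_smul_eq_sum_minors, sum_fredholmMinor,
      ← mul_assoc, div_mul_cancel₀ _ hk, Finset.mul_sum]
    refine Finset.sum_congr rfl fun s hs => ?_
    change (-(M.submatrix Subtype.val Subtype.val)).det = _
    rw [Matrix.det_neg, Fintype.card_coe, (Finset.mem_powersetCard.1 hs).2]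
  have hdeg : q.natDegree < d := by
    refine lt_of_le_of_lt ?_ hd
    rw [Polynomial.natDegree_le_iff_coeff_eq_zero]
    intro k hk
    rw [hq, Matrix.coeff_det_one_add_X_smul_eq_sum_minors, Finset.powersetCard_eq_empty.2,
      Finset.sum_empty]
    simpa using hk
  have heval : q.eval 1 = (1 - M).det := by
    rw [hq, ← Polynomial.coe_evalRingHom, RingHom.map_det]
    congr 1
    ext i j
    by_cases hij : i = j <;> simp [hij, sub_eq_add_neg]
  rw [← heval, Polynomial.eval_eq_sum_range' hdeg]
  exact Finset.sum_congr rfl fun k _ => by rw [hcoeff, one_pow, mul_one]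

/-- If all minors with a point outside a finite set vanish, then the Fredholm determinant is a
finite determinant. -/
lemma fredholm_of_finset {ι : Type*} [DecidableEq ι] (K : ι → ι → ℂ) (A : Finset ι)
    (h : ∀ (k : ℕ) (z : Fin k → ι) (l : Fin k), z l ∉ A → fredholmMinor K k z = 0) :
    FredholmSummable K ∧ fredholmDet K = (1 - Matrix.of fun b b' : ↥A => K b b').det := by
  set M : Matrix ↥A ↥A ℂ := Matrix.of fun b b' => K b b'
  have hinj : ∀ k, Injective fun (z : Fin k → ↥A) (l : Fin k) => (z l : ι) := fun k z z' h =>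
    funext fun l => Subtype.ext (congrFun h l)
  have hsupp : ∀ k, ∀ z ∉ Set.range fun (z : Fin k → ↥A) (l : Fin k) => (z l : ι),
      fredholmMinor K k z = 0 := fun k z hz => by
    by_contra hne
    exact hz ⟨fun l => ⟨z l, by_contra fun hl => hne (h k z l hl)⟩, rfl⟩
  have hterm : ∀ k, fredholmTerm K k = (-1) ^ k / (k.factorial : ℂ) *
      ∑ z : Fin k → ↥A, fredholmMinor M k z := fun k => by
    rw [fredholmTerm, ← (hinj k).tsum_eq fun z hz => by_contra fun h => hz (hsupp k z h),
      tsum_fintype]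
    rfl
  have hzero : ∀ k ∉ Finset.range (A.card + 1), fredholmTerm K k = 0 := fun k hk => by
    rw [hterm, Finset.sum_eq_zero, mul_zero]
    refine fun z _ => fredholmMinor_eq_zero_of_not_injective _ fun hz => ?_
    have := Fintype.card_le_of_injective z hz
    simp only [Fintype.card_fin, Fintype.card_coe, Finset.mem_range] at this hk
    omega
  refine ⟨⟨fun k => ((hinj k).summable_iff (hsupp k)).1 (Summable.of_finite),
    summable_of_ne_finset_zero hzero⟩, ?_⟩
  rw [fredholmDet, tsum_eq_sum hzero, det_one_sub_eq_sum M (d := A.card + 1) (by simp)]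
  exact Finset.sum_congr rfl fun k _ => hterm k

/-- The minors of a cut kernel vanish outside a finite box, if far to the left the kernel is
strictly triangular. -/
lemma fredholm_cutKernel {m : ℕ} {n a : Fin m → ℤ} {C : ℤ} {K : Fin m × ℤ → Fin m × ℤ → ℂ}
    (hK : ∀ z w, z.2 < -C - n z.1 → K z w ≠ 0 → n z.1 < n w.1 ∧ w.2 < -C - n w.1) :
    FredholmSummable (cutKernel a K) ∧ fredholmDet (cutKernel a K) =
      (1 - Matrix.of fun b b' : ↥(box n a C) => K b b').det := by
  have h := fredholm_of_finset (cutKernel a K) (box n a C) fun k z l hl => ?_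
  · refine ⟨h.1, h.2.trans ?_⟩
    congr 2
    ext b b'
    simp [cutKernel, projBelow, (mem_box.1 b.2).2, (mem_box.1 b'.2).2]
  · by_cases hla : (z l).2 < a (z l).1
    · have hlC : (z l).2 < -C - n (z l).1 := by
        by_contra hlt
        exact hl (mem_box.2 ⟨not_lt.1 hlt, hla⟩)
      -- Among the points left of the box, take one with the largest label. A nonzero entry in its
      -- row would lead to another such point with a larger label, so the row is zero.
      obtain ⟨i, hi, hmax⟩ := (Finset.univ.filter fun i => (z i).2 < -C - n (z i).1).exists_max_image
        (fun i => n (z i).1) ⟨l, by simpa using hlC⟩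
      rw [Finset.mem_filter] at hi
      refine Matrix.det_eq_zero_of_row_eq_zero i fun j => ?_
      by_contra hne
      have hne' : K (z i) (z j) ≠ 0 := fun h0 => hne (by simp [cutKernel, h0])
      obtain ⟨h1, h2⟩ := hK _ _ hi.2 hne'
      exact absurd (hmax j (by simpa using h2)) (not_le.2 h1)
    · exact Matrix.det_eq_zero_of_row_eq_zero l fun j => by simp [cutKernel, projBelow, hla]

end

section

open scoped LaurentSeries

/-! ### The kernels as coefficients of Laurent series -/

/-- A natural power has no pole, so its zero need not belong to `S`. Hence `1/μ` may lie anywhere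
relative to the loop around `1`. -/
lemma Expands.mul_affine_pow {S : Set ℂ} {ξ : ℂ⸨X⸩} {f : ℂ → ℂ} {L : ℂ⸨X⸩}
    (hξ : ∀ a ∈ S, ξ - HahnSeries.C a ≠ 0) (hf : Expands S ξ f L) (α β : ℂ) (k : ℕ) :
    Expands S ξ (fun v => f v * (α + β * v) ^ k)
      (L * (HahnSeries.C α + HahnSeries.C β * ξ) ^ k) := by
  induction k with
  | zero => simpa using hf
  | succ k ih =>
    refine ((ih.smul α _ _).add _ _ _ _ ((ih.mul_sub hξ 0).smul β _ _)).congr' (fun v _ => ?_) ?_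
    · ring
    · rw [map_zero]
      ring

lemma SimpleLoop.oint_sum {γ : SimpleLoop} {ι : Type*} (s : Finset ι) {f : ι → ℂ → ℂ}
    (hf : ∀ i ∈ s, γ.Integrable (f i)) :
    γ.oint (fun z => ∑ i ∈ s, f i z) = ∑ i ∈ s, γ.oint (f i) := by
  simp only [SimpleLoop.oint, Finset.sum_mul]
  rw [intervalIntegral.integral_finsetSum fun i hi => hf i hi, Finset.mul_sum]

variable {p μ ν : ℂ}

lemma Params.one_sub_mul_lZeta (h : Params p μ ν) :
    1 - HahnSeries.C μ * lZeta ν = HahnSeries.C (1 - ν) * lTheta p * (lOne ν)⁻¹ := by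
  rw [eq_mul_inv_iff_mul_eq₀ (lOne_ne_zero ν), sub_mul, mul_assoc, lZeta_mul, lOne, lTheta]
  have h1 : (HahnSeries.C μ : ℂ⸨X⸩) = HahnSeries.C ν * (1 - HahnSeries.C p) + HahnSeries.C p := by
    rw [← map_one (HahnSeries.C : ℂ →+* ℂ⸨X⸩), ← map_sub, ← map_mul, ← map_add, h.rel]
    ring_nf
  rw [h1]
  simp only [map_sub, map_one]
  ring

/-- The integrals around `1` in the kernels. -/
lemma oint_one_monomial (h : Params p μ ν) {γ : SimpleLoop} (hγ : IsLoopAroundOne ν γ)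
    (A B E : ℤ) (T : ℕ) (hsum : B + E + T = -2) :
    γ.Integrable (fun u => u ^ A * (1 - u) ^ B * (1 - ν * u) ^ E * (1 - μ * u) ^ T) ∧
    (1 - ν) * γ.oint (fun u => u ^ A * (1 - u) ^ B * (1 - ν * u) ^ E * (1 - μ * u) ^ T) =
      -(lX ^ B * (lZeta ν ^ A * lTheta p ^ T)).coeff (-1) := by
  set S : Set ℂ := {z | z = 0 ∨ z = 1 ∨ 1 - ν * z = 0}
  have hξ : ∀ a ∈ S, lZeta ν - HahnSeries.C a ≠ 0 := fun a _ => lZeta_sub_ne_zero h.ne_one a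
  have hE := (((((Expands.one (ξ := lZeta ν) (S := S) (a := 0) (Or.inl rfl)).mul_zpow_sub hξ
    (a := 0) (Or.inl rfl) A).mul_one_sub_zpow hξ (c := 1)
    (fun z hz => Or.inr (Or.inl (by linear_combination -hz))) B).mul_one_sub_zpow hξ (c := ν)
    (fun z hz => Or.inr (Or.inr hz)) E).mul_affine_pow hξ 1 (-μ) T)
  have hE' := hE.congr' (g := fun u => u ^ A * (1 - u) ^ B * (1 - ν * u) ^ E * (1 - μ * u) ^ T)
    (fun v _ => by rw [one_mul, sub_zero, one_mul, neg_mul, ← sub_eq_add_neg]) rfl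
  have hint := hE'.oint_one h.ne_one hγ.1 (fun a ha ha1 => hγ.2 a (by
    rcases ha with ha | ha | ha
    · exact Or.inl ha
    · exact absurd ha ha1
    · exact Or.inr ha))
  refine ⟨hint.1, ?_⟩
  rw [hint.2, ← coeff_C_mul, ← HahnSeries.coeff_neg]
  congr 1
  have hC : (HahnSeries.C (1 - ν) : ℂ⸨X⸩) ≠ 0 := by
    rw [Ne, map_eq_zero, sub_eq_zero]
    exact h.ne_one.symm
  have h0 := lOne_ne_zero ν
  rw [map_zero, sub_zero, map_one, one_mul, map_neg, neg_mul, one_mul, ← sub_eq_add_neg,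
    h.one_sub_mul_lZeta, one_sub_lZeta, one_sub_mul_lZeta, lZetaDeriv, ← neg_sub 1 ν, map_neg]
  -- Besides `B + E + T`, the exponent of `1 - ν` gets `1` from the derivative of the involution and
  -- `1` from the prefactor. For `lOne ν` the derivative contributes `-2`. Both totals are zero by
  -- `hsum`.
  have hpow : (HahnSeries.C (1 - ν) : ℂ⸨X⸩) ^ B * HahnSeries.C (1 - ν) ^ E *
      HahnSeries.C (1 - ν) ^ T * HahnSeries.C (1 - ν) * HahnSeries.C (1 - ν) = 1 := by
    rw [← zpow_natCast _ T, ← zpow_add₀ hC, ← zpow_add₀ hC, ← zpow_add_one₀ hC, ← zpow_add_one₀ hC,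
      hsum]
    norm_num
  have hpow' : (lOne ν)⁻¹ ^ B * (lOne ν)⁻¹ ^ E * (lOne ν)⁻¹ ^ T * lOne ν ^ (-2 : ℤ) = 1 := by
    rw [← zpow_natCast _ T, inv_zpow', inv_zpow', inv_zpow', ← zpow_add₀ h0, ← zpow_add₀ h0,
      ← zpow_add₀ h0, show -B + -E + -(T : ℤ) + -2 = 0 by omega, zpow_zero]
  simp only [mul_zpow, mul_pow]
  linear_combination (-(lX ^ B * lZeta ν ^ A * lTheta p ^ T)) * (lOne ν)⁻¹ ^ B * (lOne ν)⁻¹ ^ E *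
    (lOne ν)⁻¹ ^ T * lOne ν ^ (-2 : ℤ) * hpow - lX ^ B * lZeta ν ^ A * lTheta p ^ T * hpow'

lemma phiStar_eq {μ p : ℂ} (h : Params p μ ν) {γ : SimpleLoop} (hγ : IsLoopAroundOne ν γ)
    (n x n' y : ℤ) : phiStar ν γ n x n' y = if n < n' then psi 0 ν 0 n' y n x else 0 := by
  rw [phiStar]
  split_ifs with hn
  · have hint := (oint_one_monomial h hγ (-(n' - n)) (n' + y - n - x - 1) (-(n' + y - n - x + 1)) 0
      (by push_cast; ring)).2
    rw [SimpleLoop.oint_congr (g := fun v => (ν - 1) * (v ^ (-(n' - n)) *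
      (1 - v) ^ (n' + y - n - x - 1) * (1 - ν * v) ^ (-(n' + y - n - x + 1)) * (1 - μ * v) ^ 0)),
      SimpleLoop.oint_const_mul, ← neg_sub, neg_mul, hint, neg_neg, psi, coeff_lX_zpow_mul,
      coeff_lX_zpow_mul, pow_zero, pow_zero]
    · congr 1
      · rw [neg_sub]
      · ring
    · intro v _
      rw [zpow_neg, zpow_neg, pow_zero, div_eq_mul_inv, mul_inv]
      ring
  · rfl

/-- The expansion of the dual functions. -/
lemma dual_eq (μ ν : ℂ) (k t : ℤ) :
    lOne 1 ^ k * (lOne μ ^ (-t) * lOne ν ^ (-(k - t))) = lZeta ν ^ k * lTau μ ν ^ (-t) := by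
  rw [lZeta, lTau, mul_zpow, mul_zpow, inv_zpow', inv_zpow', show -(k - t) = -k + - -t by ring,
    zpow_add₀ (lOne_ne_zero ν)]
  ring


lemma integrand_mul_sub_inv {γ : SimpleLoop} (hγ : IsLoopAroundZero μ ν γ) {u : ℂ}
    (hu : γ.Excludes u) (N k t : ℤ) :
    γ.oint (fun v => v ^ (-N) * (1 - v) ^ k * (1 - μ * v) ^ (-t) * (1 - ν * v) ^ (-(k - t)) *
      (v - u)⁻¹) = (lX ^ (-N) * (lZeta ν ^ k * lTau μ ν ^ (-t)) *
        (lX - HahnSeries.C u)⁻¹).coeff (-1) := by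
  set S : Set ℂ := {z | z = 0 ∨ z = u ∨ z = 1 ∨ 1 - μ * z = 0 ∨ 1 - ν * z = 0}
  have hξ : ∀ a ∈ S, lX - HahnSeries.C a ≠ 0 := by
    intro a _
    rcases eq_or_ne a 0 with rfl | ha
    · simpa using lX_ne_zero
    · exact (hasConst_lX_sub a).ne_zero (neg_ne_zero.2 ha)
  have hE := (((((Expands.one (ξ := lX) (S := S) (a := 0) (Or.inl rfl)).mul_zpow_sub hξ
    (a := 0) (Or.inl rfl) (-N)).mul_one_sub_zpow hξ (c := 1)
    (fun z hz => Or.inr (Or.inr (Or.inl (by linear_combination -hz)))) k).mul_one_sub_zpow hξ (c := μ)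
    (fun z hz => Or.inr (Or.inr (Or.inr (Or.inl hz)))) (-t)).mul_one_sub_zpow hξ (c := ν)
    (fun z hz => Or.inr (Or.inr (Or.inr (Or.inr hz)))) (-(k - t))).mul_inv_sub hξ
    (a := u) (Or.inr (Or.inl rfl))
  have hE' := hE.congr' (g := fun v => v ^ (-N) * (1 - v) ^ k * (1 - μ * v) ^ (-t) *
    (1 - ν * v) ^ (-(k - t)) * (v - u)⁻¹) (fun v _ => by rw [one_mul, sub_zero, one_mul]) rfl
  rw [(hE'.oint_zero hγ.1 fun a ha ha0 => ?_).2, ← dual_eq]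
  · simp only [one_mul, map_zero, sub_zero, lOne, mul_assoc]
  · rcases ha with ha | ha | ha
    · exact absurd ha ha0
    · exact ha ▸ hu
    · exact hγ.2 a ha

/-- The geometric series `1 / (v - u) = -∑ v ^ r u ^ (-r - 1)`, cut off because there are no terms
below `-N`. It is obtained from the recursion that multiplication by `lX - u` gives for the
coefficients. -/
lemma coeff_mul_sub_inv {u : ℂ} (hu : u ≠ 0) {L : ℂ⸨X⸩} {c : ℂ} {N : ℤ}
    (hL : HasConst L c) (k : ℕ) :
    (lX ^ (-N) * L * (lX - HahnSeries.C u)⁻¹).coeff (-N - 1 + k) =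
      -∑ r ∈ Finset.range k, u ^ (-(r + 1 : ℤ)) * (lX ^ (-N) * L).coeff (-N - 1 + k - r) := by
  set G := lX ^ (-N) * L * (lX - HahnSeries.C u)⁻¹ with hG
  have hne : lX - HahnSeries.C u ≠ 0 := (hasConst_lX_sub u).ne_zero (neg_ne_zero.2 hu)
  have hrec : ∀ j, (lX ^ (-N) * L).coeff j = G.coeff (j - 1) - u * G.coeff j := by
    intro j
    have h1 : lX ^ (-N) * L = lX ^ (1 : ℤ) * G - HahnSeries.C u * G := by
      rw [zpow_one, ← sub_mul, hG, mul_comm (lX - _), inv_mul_cancel_right₀ hne]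
    rw [h1, HahnSeries.coeff_sub, coeff_lX_zpow_mul, coeff_C_mul]
  induction k with
  | zero =>
    rw [Finset.range_zero, Finset.sum_empty, neg_zero, hG, mul_assoc]
    exact coeff_lX_zpow_mul_of_lt (hL.mul ((hasConst_lX_sub u).inv (neg_ne_zero.2 hu)))
      (by push_cast; omega)
  | succ k ih =>
    have h := hrec (-N - 1 + (k + 1 : ℕ))
    rw [show -N - 1 + ((k + 1 : ℕ) : ℤ) - 1 = -N - 1 + k by push_cast; ring, ih] at h
    rw [Finset.sum_range_succ', neg_add]
    have hs : ∀ r ∈ Finset.range k, u ^ (-(((r + 1 : ℕ) : ℤ) + 1)) *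
        (lX ^ (-N) * L).coeff (-N - 1 + (k + 1 : ℕ) - (r + 1 : ℕ)) =
        u⁻¹ * (u ^ (-(r + 1 : ℤ)) * (lX ^ (-N) * L).coeff (-N - 1 + k - r)) := fun r _ => by
      rw [show -(((r + 1 : ℕ) : ℤ) + 1) = -(r + 1 : ℤ) - 1 by push_cast; ring, zpow_sub_one₀ hu,
        show -N - 1 + ((k + 1 : ℕ) : ℤ) - ((r + 1 : ℕ) : ℤ) = -N - 1 + k - r by push_cast; ring]
      ring
    rw [Finset.sum_congr rfl hs, ← Finset.mul_sum]
    rw [Nat.cast_zero, zero_add, sub_zero, zpow_neg_one, h]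
    field_simp
    ring

lemma sum_Icc_one (f : ℤ → ℂ) (k : ℕ) :
    ∑ i ∈ Finset.Icc (1 : ℤ) k, f i = ∑ r ∈ Finset.range k, f (r + 1) := by
  induction k with
  | zero => simp
  | succ k ih =>
    rw [Finset.sum_range_succ, ← ih]
    have : Finset.Icc (1 : ℤ) ((k + 1 : ℕ) : ℤ) = insert ((k : ℤ) + 1) (Finset.Icc (1 : ℤ) k) := by
      ext i
      simp only [Finset.mem_Icc, Finset.mem_insert]
      omega
    rw [this, Finset.sum_insert (by simp), add_comm]

/-- The kernel for step initial data. -/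
lemma kTildeStep_eq (h : Params p μ ν) {γ₀ γ₁ : SimpleLoop} (h₀ : IsLoopAroundZero μ ν γ₀)
    (h₁ : IsLoopAroundOne ν γ₁) (hout : MutuallyOutside γ₀ γ₁) (t : ℕ) (n x n' y : ℤ) (N : ℕ)
    (hN : n' ≤ N) : kTildeStep μ ν t γ₀ γ₁ n x n' y =
      ∑ i ∈ Finset.Icc (1 : ℤ) N, psi p ν t i (-i) n x * dualRow μ ν t 0 n' y i := by
  set L := lX ^ (-n') * (lZeta ν ^ (y + n') * lTau μ ν ^ (-(t : ℤ))) with hL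
  have hconst := hasConst_dual μ ν (y + n') (-t)
  have hu0 : ∀ u ∈ γ₁.trace, u ≠ 0 := fun u hu h0 => (h₁.2 0 (Or.inl rfl)).1 (h0 ▸ hu)
  set M : ℤ → ℂ → ℂ := fun i u => u ^ (n - i) * (1 - u) ^ (-(x + n + 1)) *
    (1 - ν * u) ^ (n + x - t - 1) * (1 - μ * u) ^ t with hM
  have hinner : ∀ u ∈ γ₁.trace, γ₀.oint (fun v =>
      (u ^ n * (1 - μ * u) ^ t * (1 - v) ^ (y + n') * (1 - ν * u) ^ (n + x - (t : ℤ) - 1)) /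
      (v ^ n' * (1 - μ * v) ^ t * (1 - u) ^ (x + n + 1) * (1 - ν * v) ^ (n' + y - (t : ℤ))) *
      ((1 - ν) / (v - u))) =
      ∑ i ∈ Finset.Icc (1 : ℤ) N, -(1 - ν) * L.coeff (-i) * M i u := by
    intro u hu
    have hc : ∀ v ∈ γ₀.trace,
        (u ^ n * (1 - μ * u) ^ t * (1 - v) ^ (y + n') * (1 - ν * u) ^ (n + x - (t : ℤ) - 1)) /
        (v ^ n' * (1 - μ * v) ^ t * (1 - u) ^ (x + n + 1) * (1 - ν * v) ^ (n' + y - (t : ℤ))) *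
        ((1 - ν) / (v - u)) = ((1 - ν) * M 0 u) * (v ^ (-n') * (1 - v) ^ (y + n') *
          (1 - μ * v) ^ (-(t : ℤ)) * (1 - ν * v) ^ (-(y + n' - t)) * (v - u)⁻¹) := by
      intro v _
      simp only [hM, zpow_neg, div_eq_mul_inv, mul_inv, sub_zero, zpow_natCast]
      rw [show n' + y - (t : ℤ) = y + n' - t by ring]
      ring
    rw [SimpleLoop.oint_congr hc, SimpleLoop.oint_const_mul,
      integrand_mul_sub_inv h₀ (hout.1 u hu)]
    -- The pole order `n'` is padded to `N`, so that the sum runs over the same labels for all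
    -- entries; only the absence of negative powers matters here.
    have hX : HasConst (lX ^ ((N : ℤ) - n')) (0 ^ ((N : ℤ) - n').toNat) := by
      have := HasConst.X.pow ((N : ℤ) - n').toNat
      rwa [← zpow_natCast, Int.toNat_of_nonneg (by omega)] at this
    have hco := coeff_mul_sub_inv (hu0 u hu) (N := N) (hX.mul hconst) N
    have hLN : lX ^ (-(N : ℤ)) * (lX ^ ((N : ℤ) - n') * (lZeta ν ^ (y + n') *
        lTau μ ν ^ (-(t : ℤ)))) = L := by
      rw [← mul_assoc, ← zpow_add₀ lX_ne_zero, hL]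
      congr 2
      ring
    rw [hLN, show -(N : ℤ) - 1 + N = -1 by ring] at hco
    rw [hco, sum_Icc_one, mul_neg, ← neg_mul, Finset.mul_sum]
    refine Finset.sum_congr rfl fun r _ => ?_
    simp only [hM]
    rw [show -1 - (r : ℤ) = -(r + 1 : ℤ) by ring, sub_zero, sub_eq_add_neg n (r + 1 : ℤ),
      zpow_add₀ (hu0 u hu)]
    ring
  rw [kTildeStep, SimpleLoop.oint_congr hinner, SimpleLoop.oint_sum]
  · refine Finset.sum_congr rfl fun i _ => ?_
    have hi := (oint_one_monomial h h₁ (n - i) (-(x + n + 1)) (n + x - t - 1) t (by ring)).2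
    rw [SimpleLoop.oint_const_mul, mul_comm (-(1 - ν)), mul_assoc, neg_mul, hi, neg_neg, mul_comm]
    congr 1
    · rw [psi, coeff_lX_zpow_mul, coeff_lX_zpow_mul]
      congr 1
      ring
    · rw [dualRow, hL, Nat.cast_zero, zero_sub]
  · intro i _
    exact (oint_one_monomial h h₁ (n - i) (-(x + n + 1)) (n + x - t - 1) t (by ring)).1.const_mul _

lemma exists_eq_lX_zpow_mul {L : ℂ⸨X⸩} {d : ℤ} (h : ∀ i < d, L.coeff i = 0) :
    ∃ (M : ℂ⸨X⸩) (c : ℂ), HasConst M c ∧ L = lX ^ d * M := by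
  refine ⟨HahnSeries.ofPowerSeries ℤ ℂ (PowerSeries.mk fun k => L.coeff (d + k)), _,
    ⟨_, rfl, rfl⟩, ?_⟩
  ext i
  rw [coeff_lX_zpow_mul, PowerSeries.coeff_coe]
  split_ifs with hi
  · exact h i (by omega)
  · rw [PowerSeries.coeff_mk]
    congr 1
    omega

/-- The kernel for alternating initial data as a coefficient of a Laurent series. -/
lemma kTildeAlt_eq_coeff {γ₀ : SimpleLoop} (h₀ : IsLoopAroundZero μ ν γ₀)
    (t : ℕ) (n x n' y : ℤ) : kTildeAlt p μ ν t γ₀ n x n' y =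
      (lX ^ (-n) * (lZeta ν ^ n * lTheta p ^ t) *
        (lX ^ (-n') * (lZeta ν ^ (y + n') * lTau μ ν ^ (-(t : ℤ))))).coeff x := by
  set S : Set ℂ := {z | z = 0 ∨ z = 1 ∨ 1 - μ * z = 0 ∨ 1 - ν * z = 0}
  have hξ : ∀ a ∈ S, lX - HahnSeries.C a ≠ 0 := by
    intro a _
    rcases eq_or_ne a 0 with rfl | ha
    · simpa using lX_ne_zero
    · exact (hasConst_lX_sub a).ne_zero (neg_ne_zero.2 ha)
  have hE := ((((((Expands.one (ξ := lX) (S := S) (a := 0) (Or.inl rfl)).mul_zpow_sub hξ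
    (a := 0) (Or.inl rfl) (-(x + n + n' + 1))).mul_one_sub_zpow hξ (c := 1)
    (fun z hz => Or.inr (Or.inl (by linear_combination -hz))) (y + n' + n)).mul_one_sub_zpow hξ
    (c := μ) (fun z hz => Or.inr (Or.inr (Or.inl hz))) (-t)).mul_one_sub_zpow hξ (c := ν)
    (fun z hz => Or.inr (Or.inr (Or.inr hz))) (-(y + n' + n - t))).mul_affine_pow hξ (1 - p) p t)
  have hE' := hE.congr' (g := fun v => ((1 - v) ^ (y + n' + n) * (1 - p + v * p) ^ t) /
      (v ^ (x + n + n' + 1) * (1 - μ * v) ^ t * (1 - ν * v) ^ (y + n' + n - (t : ℤ))))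
    (fun v _ => by
      rw [one_mul, sub_zero, one_mul, zpow_neg, zpow_neg, zpow_neg, zpow_natCast, div_eq_mul_inv,
        mul_inv, mul_inv]
      ring) rfl
  rw [kTildeAlt, (hE'.oint_zero h₀.1 fun a ha ha0 => h₀.2 a (ha.resolve_left ha0)).2]
  have hL : 1 * (lX - HahnSeries.C 0) ^ (-(x + n + n' + 1)) *
      (1 - HahnSeries.C 1 * lX) ^ (y + n' + n) * (1 - HahnSeries.C μ * lX) ^ (-(t : ℤ)) *
      (1 - HahnSeries.C ν * lX) ^ (-(y + n' + n - t)) *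
      (HahnSeries.C (1 - p) + HahnSeries.C p * lX) ^ t =
      lX ^ (-(x + 1)) * (lX ^ (-n) * (lZeta ν ^ n * lTheta p ^ t) *
        (lX ^ (-n') * (lZeta ν ^ (y + n') * lTau μ ν ^ (-(t : ℤ))))) := by
    have hd := dual_eq μ ν (y + n' + n) t
    rw [lOne, lOne, lOne] at hd
    rw [one_mul, map_zero, sub_zero, ← lTheta,
      show -(x + n + n' + 1) = -(x + 1) + -n + -n' by ring, zpow_add₀ lX_ne_zero,
      zpow_add₀ lX_ne_zero]
    rw [zpow_add₀ (lZeta_ne_zero ν) (y + n') n] at hd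
    linear_combination lX ^ (-(x + 1)) * lX ^ (-n) * lX ^ (-n') * lTheta p ^ t * hd
  rw [hL, coeff_lX_zpow_mul]
  congr 1
  ring

lemma kTildeAlt_eq_zero {γ₀ : SimpleLoop} (h₀ : IsLoopAroundZero μ ν γ₀)
    (t : ℕ) {n x n' y : ℤ} (hx : x < -n - n') : kTildeAlt p μ ν t γ₀ n x n' y = 0 := by
  rw [kTildeAlt_eq_coeff h₀, mul_mul_mul_comm, ← zpow_add₀ lX_ne_zero]
  exact coeff_lX_zpow_mul_of_lt ((((hasConst_lZeta ν).zpow_one n).mul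
    ((hasConst_lTheta p).pow t)).mul (hasConst_dual μ ν _ _)) (by omega)

/-- The kernel for alternating initial data, expanded in the dual functions. -/
lemma kTildeAlt_eq_sum {γ₀ : SimpleLoop} (h₀ : IsLoopAroundZero μ ν γ₀)
    (t : ℕ) {n x n' y c N : ℤ} (hN : n' ≤ N) (hx : x ≤ -c - n) (Φ : ↥(Finset.Icc c N) → ℂ)
    (hΦ : ∀ j : ↥(Finset.Icc c N), ∑ i, Φ i * dualRow μ ν t t i.1 (-2 * i.1) j =
      dualRow μ ν t 0 n' y j) :
    kTildeAlt p μ ν t γ₀ n x n' y =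
      ∑ i : ↥(Finset.Icc c N), psi p ν t i.1 (-2 * i.1) n x * Φ i := by
  set A := lX ^ (-n) * (lZeta ν ^ n * lTheta p ^ t) with hA
  set B := lX ^ (-n') * (lZeta ν ^ (y + n') * lTau μ ν ^ (-(t : ℤ))) with hB
  set E : ℤ → ℂ⸨X⸩ := fun i => lX ^ (-i) * (lZeta ν ^ (-2 * i + i) * lTau μ ν ^ ((t : ℤ) - t))
    with hE
  have hcoeff_sum : ∀ (f : ↥(Finset.Icc c N) → ℂ⸨X⸩) (k : ℤ),
      (∑ i, f i).coeff k = ∑ i, (f i).coeff k := fun f k => by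
    simp
  have hvan : ∀ k < 1 - c, (B - ∑ i : ↥(Finset.Icc c N), HahnSeries.C (Φ i) * E i).coeff k = 0 := by
    intro k hk
    rw [HahnSeries.coeff_sub, hcoeff_sum, sub_eq_zero]
    simp only [coeff_C_mul]
    rcases le_or_gt (-k) N with hkN | hkN
    · have := (hΦ ⟨-k, Finset.mem_Icc.2 ⟨by omega, hkN⟩⟩).symm
      simpa only [dualRow, neg_neg, Nat.cast_zero, zero_sub, hB, hE] using this
    · rw [hB, coeff_lX_zpow_mul_of_lt (hasConst_dual μ ν _ _) (by omega)]
      refine (Finset.sum_eq_zero fun i _ => ?_).symm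
      have := (Finset.mem_Icc.1 i.2).2
      rw [hE, coeff_lX_zpow_mul_of_lt (hasConst_dual μ ν _ _) (by omega), mul_zero]
  obtain ⟨M, d, hM, hBM⟩ := exists_eq_lX_zpow_mul hvan
  rw [sub_eq_iff_eq_add] at hBM
  rw [kTildeAlt_eq_coeff h₀, ← hA, ← hB, hBM, mul_add, HahnSeries.coeff_add, Finset.mul_sum, hcoeff_sum]
  -- The remainder starts at degree `1 - c` and `A` at `-n`, while `x ≤ -c - n`. Cutting the dual
  -- expansion off at the label `c` is therefore exact.
  have hrest : (A * (lX ^ (1 - c) * M)).coeff x = 0 := by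
    rw [hA, mul_mul_mul_comm, ← zpow_add₀ lX_ne_zero]
    exact coeff_lX_zpow_mul_of_lt ((((hasConst_lZeta ν).zpow_one n).mul
      ((hasConst_lTheta p).pow t)).mul hM) (by omega)
  rw [hrest, zero_add]
  refine Finset.sum_congr rfl fun i _ => ?_
  rw [mul_left_comm, coeff_C_mul, mul_comm, psi]
  congr 2
  simp only [hA, hE]
  rw [sub_self, zpow_zero, mul_one, show -2 * i.1 + i.1 = -i.1 by ring, sub_eq_add_neg,
    sub_eq_add_neg, zpow_add₀ lX_ne_zero, zpow_add₀ (lZeta_ne_zero ν)]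
  ring

end

section

open Function

/-! ### The evolution of the process -/

variable {Ω : Type*} [mΩ : MeasurableSpace Ω] {P : Measure Ω} {p μ : ℝ} {I : Set ℤ}
  {x₀ : ℤ → ℤ} {X : ℕ → ℤ → Ω → ℤ}

/-- The event that the particle `n` jumps in the update `τ → τ + 1`. -/
def jumpSet (X : ℕ → ℤ → Ω → ℤ) (τ : ℕ) (n : ℤ) : Set Ω := {ω | X (τ + 1) n ω = X τ n ω + 1}

/-- The configuration in which the particles `c, …, N` have the positions `Z` and the others have
the positions `y`. -/
def window (c N : ℤ) (y : ℤ → ℤ) (Z : ℤ → Ω → ℤ) (ω : Ω) (i : ℤ) : ℤ :=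
  if c ≤ i ∧ i ≤ N then Z i ω else y i

omit mΩ in
lemma measurable_window {m : MeasurableSpace Ω} {c N : ℤ} {y : ℤ → ℤ} {Z : ℤ → Ω → ℤ}
    (hZ : ∀ i, c ≤ i → i ≤ N → Measurable[m] (Z i)) (U : (ℤ → ℤ) → ℂ) :
    Measurable[m] fun ω => U (window c N y Z ω) := by
  let κ : Ω → ↥(Finset.Icc c N) → ℤ := fun ω i => Z i ω
  have hκ : Measurable[m] κ := @measurable_pi_lambda _ _ _ m _ _ fun i =>
    hZ i (Finset.mem_Icc.1 i.2).1 (Finset.mem_Icc.1 i.2).2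
  let F : (↥(Finset.Icc c N) → ℤ) → ℂ := fun v =>
    U fun i => if h : c ≤ i ∧ i ≤ N then v ⟨i, Finset.mem_Icc.2 h⟩ else y i
  have hF : Measurable F := measurable_of_countable F
  have : (fun ω => U (window c N y Z ω)) = F ∘ κ := by
    funext ω
    simp only [F, κ, comp_apply, dite_eq_ite]
    rfl
  rw [this]
  exact @Measurable.comp _ _ _ m _ _ _ _ hF hκ

lemma integrable_window [IsFiniteMeasure P] {c N : ℤ} {y : ℤ → ℤ} {Z : ℤ → Ω → ℤ}
    (hZ : ∀ i, c ≤ i → i ≤ N → Measurable (Z i)) {lo hi : ℤ → ℤ}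
    (hb : ∀ i, c ≤ i → i ≤ N → ∀ᵐ ω ∂P, lo i ≤ Z i ω ∧ Z i ω ≤ hi i) (U : (ℤ → ℤ) → ℂ) :
    Integrable (fun ω => U (window c N y Z ω)) P := by
  let F : (↥(Finset.Icc c N) → ℤ) → ℂ := fun v =>
    U fun i => if h : c ≤ i ∧ i ≤ N then v ⟨i, Finset.mem_Icc.2 h⟩ else y i
  let A : Finset (↥(Finset.Icc c N) → ℤ) := Fintype.piFinset fun i => Finset.Icc (lo i) (hi i)
  have hae : ∀ᵐ ω ∂P, ∀ i : ↥(Finset.Icc c N), lo i ≤ Z i ω ∧ Z i ω ≤ hi i :=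
    ae_all_iff.2 fun i => hb i (Finset.mem_Icc.1 i.2).1 (Finset.mem_Icc.1 i.2).2
  refine Integrable.of_bound (measurable_window hZ U).aestronglyMeasurable (∑ v ∈ A, ‖F v‖) ?_
  filter_upwards [hae] with ω hω
  have hmem : (fun i : ↥(Finset.Icc c N) => Z i ω) ∈ A :=
    Fintype.mem_piFinset.2 fun i => Finset.mem_Icc.2 (hω i)
  have : U (window c N y Z ω) = F fun i => Z i ω := by
    simp only [F, dite_eq_ite]
    rfl
  rw [this]
  exact Finset.single_le_sum (f := fun v => ‖F v‖) (fun _ _ => norm_nonneg _) hmem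

namespace IsGTASEP

variable (h : IsGTASEP P p μ I x₀ X)
include h

lemma past_le {n : ℤ} (τ : ℕ) : past I X τ n ≤ mΩ := by
  refine sup_le ?_ ?_
  · exact iSup_le fun s => iSup_le fun _ => iSup_le fun k => iSup_le fun hk =>
      (h.measurable s k hk).comap_le
  · exact iSup_le fun k => iSup_le fun hk => iSup_le fun _ => (h.measurable _ k hk).comap_le

omit h mΩ in
lemma measurable_past_old {τ s : ℕ} (hs : s ≤ τ) {k : ℤ} (hk : k ∈ I) (n : ℤ) :
    Measurable[past I X τ n] (X s k) := by
  rw [measurable_iff_comap_le]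
  exact le_sup_of_le_left (le_iSup_of_le s (le_iSup_of_le hs (le_iSup_of_le k
    (le_iSup_of_le hk le_rfl))))

omit h mΩ in
lemma measurable_past_new {τ : ℕ} {k n : ℤ} (hk : k ∈ I) (hkn : k < n) :
    Measurable[past I X τ n] (X (τ + 1) k) := by
  rw [measurable_iff_comap_le]
  exact le_sup_of_le_right (le_iSup_of_le k (le_iSup_of_le hk (le_iSup_of_le hkn le_rfl)))

lemma measurableSet_jumpSet (τ : ℕ) {n : ℤ} (hn : n ∈ I) : MeasurableSet (jumpSet X τ n) :=
  measurableSet_eq_fun (h.measurable _ n hn) ((h.measurable _ n hn).add_const 1)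

lemma bounds (τ : ℕ) {n : ℤ} (hn : n ∈ I) : ∀ᵐ ω ∂P, x₀ n ≤ X τ n ω ∧ X τ n ω ≤ x₀ n + τ := by
  induction τ with
  | zero =>
    filter_upwards [h.init n hn] with ω hω
    simp [hω]
  | succ τ ih =>
    filter_upwards [ih, h.step τ n hn] with ω h1 h2
    push_cast
    omega

/-- The defining property of the jump probabilities, for integrals. -/
lemma setIntegral_jump [IsProbabilityMeasure P] (τ : ℕ) {n : ℤ} (hn : n ∈ I) {H : Set Ω}
    (hH : MeasurableSet[past I X τ n] H) {g : Ω → ℂ} (hg : Measurable[past I X τ n] g)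
    (hgi : Integrable g P) :
    ∫ ω in H ∩ jumpSet X τ n, g ω ∂P = ∫ ω in H, (jumpProb p μ I X τ n ω : ℂ) * g ω ∂P := by
  have hle : past I X τ n ≤ mΩ := h.past_le τ
  have hJ := h.measurableSet_jumpSet τ hn
  set f : Ω → ℝ := (jumpSet X τ n).indicator fun _ => (1 : ℝ) with hf
  have hfi : Integrable f P := (integrable_const (1 : ℝ)).indicator hJ
  have hfg : f • g = (jumpSet X τ n).indicator g := by
    funext ω
    by_cases hω : ω ∈ jumpSet X τ n <;> simp [hf, hω]
  have hfgi : Integrable (f • g) P := hfg ▸ hgi.indicator hJ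
  have hc := condExp_smul_of_aestronglyMeasurable_right hfi hfgi
    (hg.stronglyMeasurable.aestronglyMeasurable)
  have hj := h.jump τ n hn
  rw [← setIntegral_indicator hJ, ← hfg, ← setIntegral_condExp hle hfgi hH]
  refine integral_congr_ae (ae_restrict_of_ae ?_)
  filter_upwards [hc, hj] with ω h1 h2
  rw [h1, Pi.smul_apply', ← h2]
  simp only [Complex.real_smul]
  rfl

/-- Exclusion is not part of `IsGTASEP`. It could only fail if a particle jumped onto a site whose
occupant stays, and there `jumpProb` is zero. -/
lemma ae_lt [IsProbabilityMeasure P] {i : ℤ} (hi : i ∈ I) (hi' : i + 1 ∈ I)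
    (h0 : x₀ (i + 1) < x₀ i) (τ : ℕ) : ∀ᵐ ω ∂P, X τ (i + 1) ω < X τ i ω := by
  induction τ with
  | zero =>
    filter_upwards [h.init i hi, h.init _ hi'] with ω h1 h2
    rwa [h1, h2]
  | succ τ ih =>
    set H : Set Ω := {ω | X τ i ω = X τ (i + 1) ω + 1} ∩ {ω | X (τ + 1) i ω = X τ i ω} with hHdef
    have m1 := measurable_past_old (X := X) (le_refl τ) hi (i + 1)
    have m2 := measurable_past_old (X := X) (le_refl τ) hi' (i + 1)
    have m3 := measurable_past_new (X := X) (τ := τ) hi (lt_add_one i)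
    have hH : MeasurableSet[past I X τ (i + 1)] H :=
      @MeasurableSet.inter _ (past I X τ (i + 1)) _ _
        (measurableSet_eq_fun (m := past I X τ (i + 1)) m1 (m2.add_const 1))
        (measurableSet_eq_fun (m := past I X τ (i + 1)) m3 m1)
    have hint := h.setIntegral_jump τ hi' hH (g := fun _ => (1 : ℂ)) (by fun_prop)
      (integrable_const 1)
    have hzero : ∫ ω in H, (jumpProb p μ I X τ (i + 1) ω : ℂ) * 1 ∂P = 0 := by
      rw [setIntegral_congr_fun (g := fun _ => (0 : ℂ)) (h.past_le τ H hH), integral_zero]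
      rintro ω ⟨h1, h2⟩
      simp only [Set.mem_ofPred_eq] at h1 h2
      have h3 : X (τ + 1) i ω ≠ X τ i ω + 1 := by omega
      simp [jumpProb, hi, h1, h2]
    rw [hzero, setIntegral_const, Complex.real_smul, mul_one] at hint
    have hnull : P (H ∩ jumpSet X τ (i + 1)) = 0 := by
      rw [← measureReal_eq_zero_iff]
      exact_mod_cast hint
    filter_upwards [ih, h.step τ i hi, h.step τ _ hi', measure_eq_zero_iff_ae_notMem.1 hnull]
      with ω h1 h2 h3 h4
    by_contra hlt
    refine h4 ⟨⟨?_, ?_⟩, ?_⟩ <;> simp only [jumpSet, Set.mem_ofPred_eq] <;> omega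

/-- The joint law of the positions after one update, on an event `H` of the past on which the
positions of the particles `c, c + 1, …` are fixed and the site in front of `c` is empty. -/
lemma setIntegral_stepExp [IsProbabilityMeasure P] (τ : ℕ) {c : ℤ} {D : ℕ} {y : ℤ → ℤ} {H : Set Ω}
    (hI : ∀ i, c ≤ i → i ≤ c + D → i ∈ I) (hH : ∀ n, MeasurableSet[past I X τ n] H)
    (hy : ∀ ω ∈ H, ∀ i, c ≤ i → i ≤ c + D → X τ i ω = y i)
    (hc : ∀ ω ∈ H, ¬ (c - 1 ∈ I ∧ X τ (c - 1) ω = y c + 1)) {d : ℕ} (hd : d ≤ D)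
    (U : (ℤ → ℤ) → ℂ) :
    ∫ ω in H ∩ jumpSet X τ (c + d), U (window c (c + d) y (X (τ + 1)) ω) ∂P =
        P.real H * (stepExp p μ c y d).1 U ∧
      ∫ ω in H \ jumpSet X τ (c + d), U (window c (c + d) y (X (τ + 1)) ω) ∂P =
        P.real H * (stepExp p μ c y d).2 U := by
  have hHm : MeasurableSet H := h.past_le τ H (hH 0)
  have hint : ∀ d ≤ D, ∀ V : (ℤ → ℤ) → ℂ,
      Integrable (fun ω => V (window c (c + d) y (X (τ + 1)) ω)) P := fun d hd V =>
    integrable_window (lo := x₀) (hi := fun i => x₀ i + (τ + 1 : ℕ))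
      (fun i h1 h2 => h.measurable _ i (hI i h1 (by omega)))
      (fun i h1 h2 => h.bounds (τ + 1) (hI i h1 (by omega))) V
  induction d generalizing U with
  | zero =>
    have hcI : c ∈ I := hI c le_rfl (by omega)
    have hJ := h.measurableSet_jumpSet τ hcI
    have key : ∀ w : ℂ, ∫ ω in H ∩ jumpSet X τ c, w ∂P = P.real H * (p * w) := fun w => by
      rw [h.setIntegral_jump τ hcI (hH c) (g := fun _ => w) (by fun_prop) (integrable_const w),
        setIntegral_congr_fun (g := fun _ => (p : ℂ) * w) hHm, setIntegral_const,
        Complex.real_smul]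
      intro ω hω
      have := hc ω hω
      rw [← hy ω hω c le_rfl (by omega)] at this
      simp only [jumpProb, if_neg this]
    simp only [Nat.cast_zero, add_zero, stepExp_zero_fst, stepExp_zero_snd]
    constructor
    · rw [← key, setIntegral_congr_fun (hHm.inter hJ)]
      rintro ω ⟨h1, h2⟩
      have h2 : X (τ + 1) c ω = X τ c ω + 1 := h2
      have h3 := hy ω h1 c le_rfl (by omega)
      refine congrArg U (funext fun i => ?_)
      rcases eq_or_ne i c with rfl | hne
      · simp [window, h2, h3]
      · rw [window, if_neg (by omega), update_of_ne hne]
    · have hsplit := integral_inter_add_sdiff (s := H) (μ := P) hJ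
        (integrable_const (U y)).integrableOn
      have hH' : ∫ ω in H, U y ∂P = P.real H * U y := by
        rw [setIntegral_const, Complex.real_smul]
      rw [key, hH'] at hsplit
      have : ∫ ω in H \ jumpSet X τ c, U (window c c y (X (τ + 1)) ω) ∂P =
          ∫ ω in H \ jumpSet X τ c, U y ∂P := by
        refine setIntegral_congr_ae (hHm.diff hJ) ?_
        filter_upwards [h.step τ c hcI] with ω hs hω
        have h2 : ¬ X (τ + 1) c ω = X τ c ω + 1 := hω.2
        have h3 := hy ω hω.1 c le_rfl (by omega)
        refine congrArg U (funext fun i => ?_)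
        rcases eq_or_ne i c with rfl | hne
        · simp only [window, le_refl, and_self, if_true]
          omega
        · rw [window, if_neg (by omega)]
      rw [this]
      linear_combination hsplit
  | succ d ih =>
    set k := c + (d + 1 : ℕ) with hk
    have hk' : c + (d : ℤ) + 1 = k := by rw [hk]; push_cast; ring
    have hkI : k ∈ I := hI k (by omega) (by omega)
    have hkI' : k - 1 ∈ I := hI _ (by omega) (by omega)
    have hJ := h.measurableSet_jumpSet τ hkI
    have hJ' := h.measurableSet_jumpSet τ hkI'
    have hkd : k - 1 = c + d := by omega
    have hmeas : ∀ V : (ℤ → ℤ) → ℂ, Measurable[past I X τ k]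
        fun ω => V (window c (c + d) y (X (τ + 1)) ω) := fun V =>
      measurable_window (fun i h1 h2 =>
        measurable_past_new (hI i h1 (by omega)) (by omega)) V
    have htot : ∀ V : (ℤ → ℤ) → ℂ, ∫ ω in H, V (window c (c + d) y (X (τ + 1)) ω) ∂P =
        P.real H * ((stepExp p μ c y d).1 V + (stepExp p μ c y d).2 V) := fun V => by
      rw [← integral_inter_add_sdiff (hkd ▸ hJ') (hint d (by omega) V).integrableOn,
        (ih (by omega) V).1, (ih (by omega) V).2, mul_add]
    have hmove : ∫ ω in H ∩ jumpSet X τ k, U (window c k y (X (τ + 1)) ω) ∂P =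
        ∫ ω in H ∩ jumpSet X τ k, moveTo k (y k + 1) U (window c (c + d) y (X (τ + 1)) ω) ∂P := by
      refine setIntegral_congr_fun (hHm.inter hJ) ?_
      rintro ω ⟨h1, h2⟩
      have h2 : X (τ + 1) k ω = X τ k ω + 1 := h2
      have h3 := hy ω h1 k (by omega) (by omega)
      refine congrArg U (funext fun i => ?_)
      change window c k y (X (τ + 1)) ω i =
        update (window c (c + d) y (X (τ + 1)) ω) k (y k + 1) i
      rcases eq_or_ne i k with rfl | hne
      · rw [update_self, window, if_pos ⟨by omega, le_rfl⟩, h2, h3]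
      · rw [update_of_ne hne, window, window]
        by_cases hi : c ≤ i ∧ i ≤ c + d
        · rw [if_pos hi, if_pos (by omega)]
        · rw [if_neg hi, if_neg (by omega)]
    have hstay : ∫ ω in H \ jumpSet X τ k, U (window c k y (X (τ + 1)) ω) ∂P =
        ∫ ω in H \ jumpSet X τ k, U (window c (c + d) y (X (τ + 1)) ω) ∂P := by
      refine setIntegral_congr_ae (hHm.diff hJ) ?_
      filter_upwards [h.step τ k hkI] with ω hs hω
      have h2 : ¬ X (τ + 1) k ω = X τ k ω + 1 := hω.2
      have h3 := hy ω hω.1 k (by omega) (by omega)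
      refine congrArg U (funext fun i => ?_)
      rw [window, window]
      rcases eq_or_ne i k with rfl | hne
      · rw [if_pos ⟨by omega, le_rfl⟩, if_neg (by omega)]
        omega
      · by_cases hi : c ≤ i ∧ i ≤ c + d
        · rw [if_pos hi, if_pos (by omega)]
        · rw [if_neg hi, if_neg (by omega)]
    -- Only the jump part needs the conditional law; the part where `k` stays is the complement in
    -- the total `htot`.
    have hsplit := integral_inter_add_sdiff hJ (hint d (by omega) U).integrableOn (s := H)
    rw [htot] at hsplit
    rw [hmove, hstay]
    by_cases hyk : y (c + d) = y (c + d + 1) + 1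
    · have key : ∀ V : (ℤ → ℤ) → ℂ,
          ∫ ω in H ∩ jumpSet X τ k, V (window c (c + d) y (X (τ + 1)) ω) ∂P =
            P.real H * (μ * (stepExp p μ c y d).1 V) := fun V => by
        rw [h.setIntegral_jump τ hkI (hH k) (hmeas V) (hint d (by omega) V)]
        have : ∀ ω ∈ H, (jumpProb p μ I X τ k ω : ℂ) * V (window c (c + d) y (X (τ + 1)) ω) =
            (jumpSet X τ (c + d)).indicator
              (fun ω => (μ : ℂ) * V (window c (c + d) y (X (τ + 1)) ω)) ω := fun ω hω => by
          have h1 := hy ω hω k (by omega) (by omega)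
          have h2 := hy ω hω (c + d) (by omega) (by omega)
          have h3 : X τ (k - 1) ω = X τ k ω + 1 := by rw [hkd, h1, h2, hyk, hk']
          rw [jumpProb, if_pos ⟨hkI', h3⟩]
          by_cases hj : ω ∈ jumpSet X τ (c + d)
          · rw [Set.indicator_of_mem hj, if_pos (by rw [hkd]; exact hj)]
          · rw [Set.indicator_of_notMem hj, if_neg (by rw [hkd]; exact hj)]
            simp
        rw [setIntegral_congr_fun hHm this, setIntegral_indicator (hkd ▸ hJ'), integral_const_mul,
          (ih (by omega) V).1]
        ring
      rw [(stepExp_succ_of_eq hyk _).1, (stepExp_succ_of_eq hyk _).2, key, hk']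
      rw [key] at hsplit
      exact ⟨rfl, by linear_combination hsplit⟩
    · have key : ∀ V : (ℤ → ℤ) → ℂ,
          ∫ ω in H ∩ jumpSet X τ k, V (window c (c + d) y (X (τ + 1)) ω) ∂P =
            P.real H * (p * ((stepExp p μ c y d).1 V + (stepExp p μ c y d).2 V)) := fun V => by
        rw [h.setIntegral_jump τ hkI (hH k) (hmeas V) (hint d (by omega) V)]
        have : ∀ ω ∈ H, (jumpProb p μ I X τ k ω : ℂ) * V (window c (c + d) y (X (τ + 1)) ω) =
            (p : ℂ) * V (window c (c + d) y (X (τ + 1)) ω) := fun ω hω => by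
          have h1 := hy ω hω k (by omega) (by omega)
          have h2 := hy ω hω (c + d) (by omega) (by omega)
          have h3 : ¬ (k - 1 ∈ I ∧ X τ (k - 1) ω = X τ k ω + 1) := by
            rw [hkd, h1, h2, ← hk']
            exact fun h => hyk h.2
          rw [jumpProb, if_neg h3]
        rw [setIntegral_congr_fun hHm this, integral_const_mul, htot]
        ring
      rw [(stepExp_succ_of_ne hyk _).1, (stepExp_succ_of_ne hyk _).2, key, hk']
      rw [key] at hsplit
      exact ⟨rfl, by linear_combination hsplit⟩

end IsGTASEP

end

/-! ### The expectation of the determinantal solution along the process. -/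

section

open Function

section

variable {m : ℕ} {p μ ν : ℂ} {t : ℕ} {n a : Fin m → ℤ} {C c N : ℤ}

lemma detSol_congr {σ σ' : ℤ → ℕ} {y y' : ℤ → ℤ} (hσ : ∀ i, c ≤ i → i ≤ N → σ i = σ' i)
    (hy : ∀ i, c ≤ i → i ≤ N → y i = y' i) :
    detSol p μ ν t n a C c N σ y = detSol p μ ν t n a C c N σ' y' := by
  refine congrArg Matrix.det (Matrix.ext fun r s => ?_)
  rcases r with ⟨i, hi⟩ | b
  · have hi' := Finset.mem_Icc.1 hi
    rw [bordered_inl, bordered_inl, hσ i hi'.1 hi'.2, hy i hi'.1 hi'.2]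
  · rw [bordered_inr, bordered_inr]

/-- One update of the particles `c, …, N`, the site in front of `c` being empty. -/
lemma stepExp_detSol (h : Params p μ ν) {D : ℕ} (hD : c + D = N) (s : ℕ) (y : ℤ → ℤ) :
    (stepExp p μ c y D).1 (detSol p μ ν t n a C c N fun _ => s) +
        (stepExp p μ c y D).2 (detSol p μ ν t n a C c N fun _ => s) =
      detSol p μ ν t n a C c N (fun _ => s + 1) y := by
  set σ : ℕ → ℤ → ℕ := fun d i => if i ≤ c + d then s else s + 1 with hσ
  have hlast : (detSol p μ ν t n a C c N fun _ => s) = detSol p μ ν t n a C c N (σ D) := by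
    funext z
    refine detSol_congr (fun i _ h2 => ?_) fun _ _ _ => rfl
    simp [hσ, hD, h2]
  rw [hlast, stepExp_eq_free (U := fun d => detSol p μ ν t n a C c N (σ d)) h (D := D) ?_ ?_ le_rfl]
  · rw [← detSol_update_time h (σ 0) y (Finset.mem_Icc.2 ⟨le_rfl, by omega⟩)]
    refine detSol_congr (fun i h1 _ => ?_) fun _ _ _ => rfl
    rcases eq_or_ne i c with rfl | hne
    · simp [hσ]
    · rw [update_of_ne hne]
      exact if_neg (by push_cast; omega)
  · intro d hd i h1 h2
    refine detSol_boundaryAt _ (Finset.mem_Icc.2 ⟨h1, by omega⟩)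
      (Finset.mem_Icc.2 ⟨by omega, by omega⟩) ?_
    simp only [hσ]
    rw [if_pos (by omega), if_pos (by omega)]
  · intro d hd z
    rw [← detSol_update_time h (σ (d + 1)) z (Finset.mem_Icc.2 ⟨by omega, by omega⟩)]
    refine detSol_congr (fun i h1 _ => ?_) fun _ _ _ => rfl
    rcases eq_or_ne i (c + d + 1) with rfl | hne
    · rw [update_self]
      simp only [hσ]
      rw [if_neg (by omega), if_pos (by push_cast; omega)]
    · rw [update_of_ne hne]
      simp only [hσ]
      by_cases hi : i ≤ c + d
      · rw [if_pos hi, if_pos (by push_cast; omega)]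
      · rw [if_neg hi, if_neg (by push_cast; omega)]

end

lemma integral_eq_of_setIntegral_fiber_eq {Ω α : Type*} [MeasurableSpace Ω] {P : Measure Ω}
    [Countable α] [MeasurableSpace α] [MeasurableSingletonClass α] {κ : Ω → α} (hκ : Measurable κ)
    {f g : Ω → ℂ} (hf : Integrable f P) (hg : Integrable g P)
    (h : ∀ v, ∫ ω in κ ⁻¹' {v}, f ω ∂P = ∫ ω in κ ⁻¹' {v}, g ω ∂P) :
    ∫ ω, f ω ∂P = ∫ ω, g ω ∂P := by
  have hU : (⋃ v, κ ⁻¹' {v}) = Set.univ := Set.iUnion_eq_univ_iff.2 fun ω => ⟨κ ω, rfl⟩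
  have hd : Pairwise (Disjoint on fun v => κ ⁻¹' {v}) := fun v w hvw =>
    Disjoint.preimage _ (Set.disjoint_singleton.2 hvw)
  have hm : ∀ v, MeasurableSet (κ ⁻¹' {v}) := fun v => hκ (measurableSet_singleton v)
  rw [← setIntegral_univ, ← setIntegral_univ (f := g), ← hU,
    integral_iUnion hm hd hf.integrableOn, integral_iUnion hm hd hg.integrableOn]
  simp_rw [h]

namespace IsGTASEP

variable {Ω : Type*} [mΩ : MeasurableSpace Ω] {P : Measure Ω} [IsProbabilityMeasure P] {p μ : ℝ}
  {I : Set ℤ} {x₀ : ℤ → ℤ} {X : ℕ → ℤ → Ω → ℤ} {ν : ℂ} {m : ℕ} {t : ℕ} {n a : Fin m → ℤ}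
  {C c N M j : ℤ} (h : IsGTASEP P p μ I x₀ X)
include h

lemma setIntegral_detSol_succ (hpar : Params (p : ℂ) μ ν) (τ s : ℕ) {y : ℤ → ℤ} {H : Set Ω}
    (hcN : c ≤ N) (hI : ∀ i, c ≤ i → i ≤ N → i ∈ I) (hH : ∀ k, MeasurableSet[past I X τ k] H)
    (hy : ∀ ω ∈ H, ∀ i, c ≤ i → i ≤ N → X τ i ω = y i)
    (hc : ∀ ω ∈ H, ¬ (c - 1 ∈ I ∧ X τ (c - 1) ω = y c + 1)) :
    ∫ ω in H, detSol p μ ν t n a C c N (fun _ => s) (fun i => X (τ + 1) i ω) ∂P =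
      P.real H * detSol p μ ν t n a C c N (fun _ => s + 1) y := by
  obtain ⟨D, hD⟩ := Int.eq_ofNat_of_zero_le (sub_nonneg.2 hcN)
  have hD' : c + D = N := by omega
  set U : (ℤ → ℤ) → ℂ := detSol p μ ν t n a C c N fun _ => s with hU
  have hcongr : ∀ ω, U (fun i => X (τ + 1) i ω) = U (window c (c + D) y (X (τ + 1)) ω) :=
    fun ω => detSol_congr (fun _ _ _ => rfl) fun i h1 h2 => by
      rw [window, if_pos ⟨h1, by omega⟩]
  have hint : Integrable (fun ω => U (window c (c + D) y (X (τ + 1)) ω)) P :=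
    integrable_window (lo := x₀) (hi := fun i => x₀ i + (τ + 1 : ℕ))
      (fun i h1 h2 => h.measurable _ i (hI i h1 (by omega)))
      (fun i h1 h2 => h.bounds (τ + 1) (hI i h1 (by omega))) U
  obtain ⟨e1, e2⟩ := h.setIntegral_stepExp τ (D := D) (fun i h1 h2 => hI i h1 (by omega)) hH
    (fun ω hω i h1 h2 => hy ω hω i h1 (by omega)) hc le_rfl U
  simp_rw [hcongr]
  rw [← integral_inter_add_sdiff (h.measurableSet_jumpSet τ (hI (c + D) (by omega) (by omega)))
    hint.integrableOn, e1, e2, ← mul_add, hU, stepExp_detSol hpar hD']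

lemma integrable_detSol (τ s : ℕ) (hI : ∀ i, c ≤ i → i ≤ N → i ∈ I) :
    Integrable (fun ω => detSol p μ ν t n a C c N (fun _ => s) fun i => X τ i ω) P := by
  have := integrable_window (P := P) (c := c) (N := N) (Z := X τ) (y := 0) (lo := x₀)
    (hi := fun i => x₀ i + τ) (fun i h1 h2 => h.measurable _ i (hI i h1 h2))
    (fun i h1 h2 => h.bounds τ (hI i h1 h2)) (detSol p μ ν t n a C c N fun _ => s)
  refine this.congr (Filter.Eventually.of_forall fun ω => ?_)
  exact detSol_congr (fun _ _ _ => rfl) fun i h1 h2 => by rw [window, if_pos ⟨h1, h2⟩]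

/-- One update of the whole system, if almost surely there is a particle which is the first one of
its cluster and behind which all particles that are not in the window are far to the right. -/
lemma integral_detSol_succ (hpar : Params (p : ℂ) μ ν) (τ s : ℕ) (hMj : M ≤ j) (hjN : j ≤ N)
    (hI : ∀ i, M ≤ i → i ≤ N → i ∈ I)
    (hhead : ∀ᵐ ω ∂P, ∃ c, M ≤ c ∧ c ≤ j ∧
      (c - 1 ∉ I ∨ (M ≤ c - 1 ∧ X τ (c - 1) ω ≠ X τ c ω + 1)) ∧
      ∀ i, c ≤ i → i < j → ∀ k, a k + n k ≤ X τ i ω + i) :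
    ∫ ω, detSol p μ ν t n a C j N (fun _ => s) (fun i => X (τ + 1) i ω) ∂P =
      ∫ ω, detSol p μ ν t n a C j N (fun _ => s + 1) (fun i => X τ i ω) ∂P := by
  -- The fibres also fix the particles from `M` to `j - 1` ahead of the window. So one head `c`,
  -- which depends on the configuration, serves a whole fibre.
  let κ : Ω → ↥(Finset.Icc M N) → ℤ := fun ω i => X τ i ω
  have hκp : ∀ k, Measurable[past I X τ k] κ := fun k =>
    @measurable_pi_lambda _ _ _ (past I X τ k) _ _ fun i =>
      measurable_past_old le_rfl (hI i (Finset.mem_Icc.1 i.2).1 (Finset.mem_Icc.1 i.2).2) k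
  have hκ : Measurable κ := (hκp 0).mono (h.past_le τ) le_rfl
  refine integral_eq_of_setIntegral_fiber_eq hκ
    (h.integrable_detSol (τ + 1) s fun i h1 h2 => hI i (by omega) h2)
    (h.integrable_detSol τ (s + 1) fun i h1 h2 => hI i (by omega) h2) fun v => ?_
  set H := κ ⁻¹' {v} with hHdef
  have hHm : MeasurableSet H := hκ (measurableSet_singleton v)
  by_cases hP : P H = 0
  · rw [Measure.restrict_eq_zero.2 hP, integral_zero_measure, integral_zero_measure]
  -- A fibre of positive measure contains a point with the almost sure property, which involves only
  -- positions constant on the fibre.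
  obtain ⟨ω₀, hω₀, c, hMc, hcj, hc, hfar⟩ :
      ∃ ω₀ ∈ H, ∃ c, M ≤ c ∧ c ≤ j ∧ (c - 1 ∉ I ∨ (M ≤ c - 1 ∧ X τ (c - 1) ω₀ ≠ X τ c ω₀ + 1)) ∧
        ∀ i, c ≤ i → i < j → ∀ k, a k + n k ≤ X τ i ω₀ + i := by
    by_contra hno
    push Not at hno
    refine hP (measure_mono_null (fun ω hω => ?_) (ae_iff.1 hhead))
    rintro ⟨c, h1, h2, h3, h4⟩
    obtain ⟨i, h5, h6, k, h7⟩ := hno ω hω c h1 h2 h3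
    exact absurd (h4 i h5 h6 k) (not_le.2 h7)
  set y : ℤ → ℤ := fun i => X τ i ω₀ with hy
  have hfix : ∀ ω ∈ H, ∀ i, M ≤ i → i ≤ N → X τ i ω = y i := fun ω hω i h1 h2 => by
    have e : κ ω = κ ω₀ := (show κ ω = v from hω).trans (show κ ω₀ = v from hω₀).symm
    exact congrFun e ⟨i, Finset.mem_Icc.2 ⟨h1, h2⟩⟩
  -- The window is extended from `j` to the head `c`. The particles added are far to the right and
  -- remain so after the update.
  have hleft : ∫ ω in H, detSol p μ ν t n a C j N (fun _ => s) (fun i => X (τ + 1) i ω) ∂P =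
      ∫ ω in H, detSol p μ ν t n a C c N (fun _ => s) (fun i => X (τ + 1) i ω) ∂P := by
    refine setIntegral_congr_ae hHm ?_
    have hst : ∀ᵐ ω ∂P, ∀ i : ↥(Finset.Icc M N),
        X (τ + 1) i ω = X τ i ω ∨ X (τ + 1) i ω = X τ i ω + 1 := ae_all_iff.2 fun i =>
      h.step τ i (hI i (Finset.mem_Icc.1 i.2).1 (Finset.mem_Icc.1 i.2).2)
    filter_upwards [hst] with ω hω hωH
    refine (detSol_window hcj _ fun i h1 h2 k => ?_).symm
    have e1 := hω ⟨i, Finset.mem_Icc.2 ⟨by omega, by omega⟩⟩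
    have e2 := hfix ω hωH i (by omega) (by omega)
    have e3 := hfar i h1 h2 k
    simp only [hy] at e2
    simp only at e1
    omega
  have hright : ∫ ω in H, detSol p μ ν t n a C j N (fun _ => s + 1) (fun i => X τ i ω) ∂P =
      P.real H * detSol p μ ν t n a C j N (fun _ => s + 1) y := by
    rw [setIntegral_congr_fun (g := fun _ => detSol p μ ν t n a C j N (fun _ => s + 1) y) hHm,
      setIntegral_const, Complex.real_smul]
    exact fun ω hω => detSol_congr (fun _ _ _ => rfl) fun i h1 h2 => hfix ω hω i (by omega) h2
  rw [hleft, hright, ← detSol_window hcj _ hfar,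
    h.setIntegral_detSol_succ hpar τ s (y := y) (by omega) (fun i h1 h2 => hI i (by omega) h2)
      (fun k => hκp k (measurableSet_singleton v))
      (fun ω hω i h1 h2 => hfix ω hω i (by omega) h2)]
  rintro ω hω ⟨h1, h2⟩
  rcases hc with hc | ⟨hc, hne⟩
  · exact hc h1
  · exact hne (by rw [← h2, hfix ω hω (c - 1) hc (by omega)])

lemma integral_detSol (hpar : Params (p : ℂ) μ ν) (hMj : M ≤ j) (hjN : j ≤ N)
    (hI : ∀ i, M ≤ i → i ≤ N → i ∈ I) (τ s : ℕ)
    (hhead : ∀ r < τ, ∀ᵐ ω ∂P, ∃ c, M ≤ c ∧ c ≤ j ∧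
      (c - 1 ∉ I ∨ (M ≤ c - 1 ∧ X r (c - 1) ω ≠ X r c ω + 1)) ∧
      ∀ i, c ≤ i → i < j → ∀ k, a k + n k ≤ X r i ω + i) :
    ∫ ω, detSol p μ ν t n a C j N (fun _ => s) (fun i => X τ i ω) ∂P =
      detSol p μ ν t n a C j N (fun _ => s + τ) x₀ := by
  induction τ generalizing s with
  | zero =>
    have hinit : ∀ᵐ ω ∂P, ∀ i : ↥(Finset.Icc j N), X 0 i ω = x₀ i := ae_all_iff.2 fun i =>
      h.init i (hI i (hMj.trans (Finset.mem_Icc.1 i.2).1) (Finset.mem_Icc.1 i.2).2)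
    rw [integral_congr_ae (g := fun _ => detSol p μ ν t n a C j N (fun _ => s) x₀), integral_const]
    · simp
    · filter_upwards [hinit] with ω hω
      exact detSol_congr (fun _ _ _ => rfl) fun i h1 h2 => hω ⟨i, Finset.mem_Icc.2 ⟨h1, h2⟩⟩
  | succ τ ih =>
    rw [h.integral_detSol_succ hpar τ s hMj hjN hI (hhead τ (Nat.lt_succ_self τ)),
      ih (s + 1) fun r hr => hhead r (hr.trans (Nat.lt_succ_self τ))]
    simp only [add_assoc, add_comm 1 τ]

/-- The joint distribution of the positions as a determinant of finite size. -/
lemma measureReal_eq_detSol (hpar : Params (p : ℂ) μ ν) (hMj : M ≤ j) (hjN : j ≤ N)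
    (hI : ∀ i, M ≤ i → i ≤ N → i ∈ I) (hx : ∀ i, j ≤ i → i < N → x₀ (i + 1) < x₀ i)
    (hn : Injective n) (hjn : ∀ k, j ≤ n k) (hnN : ∀ k, n k ≤ N) (hC : ∀ k, -C - n k ≤ x₀ (n k))
    (hhead : ∀ r < t, ∀ᵐ ω ∂P, ∃ c, M ≤ c ∧ c ≤ j ∧
      (c - 1 ∉ I ∨ (M ≤ c - 1 ∧ X r (c - 1) ω ≠ X r c ω + 1)) ∧
      ∀ i, c ≤ i → i < j → ∀ k, a k + n k ≤ X r i ω + i) :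
    (P.real (⋂ k : Fin m, {ω | a k ≤ X t (n k) ω}) : ℂ) =
      detSol p μ ν t n a C j N (fun _ => t) x₀ := by
  have hkI : ∀ k, n k ∈ I := fun k => hI _ (hMj.trans (hjn k)) (hnN k)
  have hmain := h.integral_detSol (C := C) (t := t) hpar hMj hjN hI t 0 hhead
  simp only [zero_add] at hmain
  rw [← hmain]
  set E : Set Ω := ⋂ k : Fin m, {ω | a k ≤ X t (n k) ω} with hE
  have hEm : MeasurableSet E := MeasurableSet.iInter fun k =>
    measurableSet_le measurable_const (h.measurable t _ (hkI k))
  have hlt : ∀ᵐ ω ∂P, ∀ i : ↥(Finset.Ico j N), X t (i + 1) ω < X t i ω := ae_all_iff.2 fun i => by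
    obtain ⟨h1, h2⟩ := Finset.mem_Ico.1 i.2
    exact h.ae_lt (hI _ (by omega) (by omega)) (hI _ (by omega) (by omega)) (hx _ h1 h2) t
  have hlo : ∀ᵐ ω ∂P, ∀ k, x₀ (n k) ≤ X t (n k) ω := ae_all_iff.2 fun k =>
    (h.bounds t (hkI k)).mono fun _ h => h.1
  rw [integral_congr_ae (g := E.indicator fun _ => (1 : ℂ)), integral_indicator hEm,
    setIntegral_const, Complex.real_smul, mul_one]
  classical
  filter_upwards [hlt, hlo] with ω h1 h2
  rw [detSol_zero hn (fun k => Finset.mem_Icc.2 ⟨hjn k, hnN k⟩)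
    (fun i h3 h4 => h1 ⟨i, Finset.mem_Ico.2 ⟨h3, h4⟩⟩) (fun k => (hC k).trans (h2 k)),
    Set.indicator_apply]
  simp [hE]

end IsGTASEP

end

/-! ### Step and alternating initial data. -/

section

open Function

lemma params_nu {p μ : ℝ} (hp₁ : p < 1) (hμ₁ : μ < 1) : Params (p : ℂ) (μ : ℂ) (nu p μ : ℂ) where
  rel := by
    have h : nu p μ * (1 - p) = μ - p := div_mul_cancel₀ _ (by linarith)
    exact_mod_cast h
  ne_one := by
    have h : nu p μ ≠ 1 := by
      rw [nu, Ne, div_eq_one_iff_eq (by linarith)]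
      intro h
      linarith
    exact_mod_cast h

/-- For step initial data both exponents vanish: the initial dual matrix is the identity, and the
coordinates of a site are its own dual row. -/
lemma dualRow_terminal (μ ν : ℂ) (t : ℕ) (i j : ℤ) :
    dualRow μ ν t t i (-i) j = if i = j then 1 else 0 := by
  rcases eq_or_ne i j with rfl | hne
  · rw [dualRow_self, if_pos rfl]
  · rw [dualRow, neg_add_cancel, sub_self, zpow_zero, zpow_zero, one_mul, mul_one, if_neg hne, lX_zpow,
      HahnSeries.coeff_single_of_ne (by simpa using hne.symm)]

lemma phi_ne_zero {m : ℕ} {ν : ℂ} {n : Fin m → ℤ} {z w : Fin m × ℤ} (h : phi ν n z w ≠ 0) :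
    n z.1 < n w.1 ∧ w.2 + n w.1 ≤ z.2 + n z.1 := by
  rw [phi] at h
  split_ifs at h with hn
  · refine ⟨hn, ?_⟩
    by_contra hlt
    exact h (psi_eq_zero (by omega))
  · exact absurd rfl h

/-- The passage from the finite determinant to the Fredholm determinant. -/
lemma fredholm_of_kernel {m : ℕ} {n a : Fin m → ℤ} {t : ℕ} {x₀ : ℤ → ℤ} {p μ ν q : ℂ} {C c N : ℤ}
    {K L : Fin m × ℤ → Fin m × ℤ → ℂ} (hK : ∀ z w, K z w = -phi ν n z w + L z w)
    (hL : ∀ z w, z.2 < -C - n z.1 → L z w = 0) (Φ : Matrix ↥(box n a C) ↥(Finset.Icc c N) ℂ)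
    (hΦ : ∀ b (j : ↥(Finset.Icc c N)), ∑ i, Φ b i * dualRow μ ν t t i.1 (x₀ i.1) j =
      dualRow μ ν t 0 (n b.1.1) b.1.2 j)
    (hLΦ : ∀ b ∈ box n a C, ∀ b' : ↥(box n a C), L b b' =
      ∑ i : ↥(Finset.Icc c N), psi p ν t i.1 (x₀ i.1) (n b.1) b.2 * Φ b' i)
    (hq : q = detSol p μ ν t n a C c N (fun _ => t) x₀) :
    FredholmSummable (cutKernel a K) ∧ q = fredholmDet (cutKernel a K) := by
  have h := fredholm_cutKernel (n := n) (a := a) (C := C) (K := K) fun z w hz hzw => by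
    rw [hK, hL z w hz, add_zero, neg_ne_zero] at hzw
    obtain ⟨h1, h2⟩ := phi_ne_zero hzw
    exact ⟨h1, by omega⟩
  refine ⟨h.1, ?_⟩
  rw [hq, h.2]
  exact detSol_eq_det_one_sub Φ hΦ fun b hb b' => by rw [hK, hLΦ b hb b']

section

variable {Ω : Type*} [MeasurableSpace Ω] {P : Measure Ω} [IsProbabilityMeasure P] {p μ : ℝ}
  {X : ℕ → ℤ → Ω → ℤ} {t m : ℕ} {n a : Fin m → ℤ} {Γ₀ Γ₁ : Fin m × ℤ → Fin m × ℤ → SimpleLoop}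

/-- The particle `1` has nobody in front of it and is always a head, so the window `1, …, N` never
has to be extended. The box starts at `-n k`, the initial position. -/
theorem step_formula (hp₁ : p < 1) (hμ₁ : μ < 1) (hn : StrictMono n)
    (hΓ₀ : ∀ z w, IsLoopAroundZero μ (nu p μ) (Γ₀ z w))
    (hΓ₁ : ∀ z w, IsLoopAroundOne (nu p μ) (Γ₁ z w)) (hX : IsStepGTASEP P p μ X)
    (hn1 : ∀ k, 1 ≤ n k) (hout : ∀ z w, MutuallyOutside (Γ₀ z w) (Γ₁ z w)) :
    let K : Fin m × ℤ → Fin m × ℤ → ℂ := cutKernel a fun z w =>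
      kStep p μ t (Γ₀ z w) (Γ₁ z w) (n z.1) z.2 (n w.1) w.2
    FredholmSummable K ∧
      (P.real (⋂ k : Fin m, {ω | a k ≤ X t (n k) ω}) : ℂ) = fredholmDet K := by
  have hpar := params_nu hp₁ hμ₁
  obtain ⟨B, hB⟩ := Finite.exists_le n
  set N : ℕ := (max B 1).toNat with hN
  have hBN : ∀ k, n k ≤ N := fun k => (hB k).trans (by omega)
  refine fredholm_of_kernel (t := t) (p := p) (μ := μ) (x₀ := fun i => -i) (C := 0) (c := 1) (N := N)
    (fun z w => by rw [kStep, phiStar_eq hpar (hΓ₁ z w)]; rfl) (fun z w hz => ?_)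
    (Matrix.of fun b i => dualRow μ (nu p μ) t 0 (n b.1.1) b.1.2 i) (fun b j => ?_)
    (fun b hb b' => ?_) ?_
  · rw [kTildeStep_eq hpar (hΓ₀ z w) (hΓ₁ z w) (hout z w) _ _ _ _ _ N (hBN _)]
    exact Finset.sum_eq_zero fun i _ => by rw [psi_eq_zero (by omega), zero_mul]
  · simp [dualRow_terminal, Subtype.ext_iff.symm]
  · rw [kTildeStep_eq hpar (hΓ₀ _ _) (hΓ₁ _ _) (hout _ _) _ _ _ _ _ N (hBN _), ← Finset.sum_coe_sort]
    rfl
  · refine IsGTASEP.measureReal_eq_detSol hX hpar (M := 1) le_rfl (by omega) (fun i h _ => h)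
      (fun i _ _ => by simp) hn.injective hn1 hBN (fun k => by simp) fun r _ =>
      Filter.Eventually.of_forall fun ω => ⟨1, le_rfl, le_rfl, Or.inl (by simp), fun i h1 h2 => by omega⟩

-- If none of the `t + 1` particles from `j - t` to `j` were a head, the particle `j - t - 1` would
-- be exactly `t + 1` sites ahead of `j`. Initially it is `2 t + 2` ahead, and after `r < t` updates
-- the gap has shrunk by at most `r`.
omit [IsProbabilityMeasure P] in
lemma IsAltGTASEP.exists_head (hX : IsAltGTASEP P p μ X) (j : ℤ) {r : ℕ} (hr : r < t) :
    ∀ᵐ ω ∂P, (∀ i, -2 * i ≤ X r i ω) ∧ ∃ c, j - t ≤ c ∧ c ≤ j ∧ X r (c - 1) ω ≠ X r c ω + 1 := by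
  have hb : ∀ᵐ ω ∂P, ∀ i, -2 * i ≤ X r i ω ∧ X r i ω ≤ -2 * i + r :=
    ae_all_iff.2 fun i => IsGTASEP.bounds hX r (Set.mem_univ i)
  filter_upwards [hb] with ω hω
  refine ⟨fun i => (hω i).1, ?_⟩
  by_contra! hno
  have key : ∀ e : ℕ, e ≤ t + 1 → X r (j - e) ω = X r j ω + e := fun e he => by
    induction e with
    | zero => simp
    | succ e ih =>
      have h1 := hno (j - e) (by omega) (by omega)
      rw [ih (by omega)] at h1
      rw [show j - ((e + 1 : ℕ) : ℤ) = j - e - 1 by push_cast; ring, h1]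
      push_cast
      ring
  have h1 := key (t + 1) le_rfl
  have h2 := (hω (j - ((t + 1 : ℕ) : ℤ))).1
  have h3 := (hω j).2
  push_cast at h1 h2
  rw [h1] at h2
  omega

theorem alternating_formula (hp₁ : p < 1) (hμ₁ : μ < 1) (hn : StrictMono n)
    (hΓ₀ : ∀ z w, IsLoopAroundZero μ (nu p μ) (Γ₀ z w))
    (hΓ₁ : ∀ z w, IsLoopAroundOne (nu p μ) (Γ₁ z w)) (hX : IsAltGTASEP P p μ X) :
    let K : Fin m × ℤ → Fin m × ℤ → ℂ := cutKernel a fun z w =>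
      kAlt p μ t (Γ₀ z w) (Γ₁ z w) (n z.1) z.2 (n w.1) w.2
    FredholmSummable K ∧
      (P.real (⋂ k : Fin m, {ω | a k ≤ X t (n k) ω}) : ℂ) = fredholmDet K := by
  have hpar := params_nu hp₁ hμ₁
  obtain ⟨j₁, hj₁⟩ := Finite.exists_ge n
  -- This bound serves twice. A particle `i < j` satisfies `X r i + i ≥ -i ≥ 1 - j ≥ a k + n k`,
  -- hence is far to the right. A box point satisfies `x ≤ -j - n k`, as `kTildeAlt_eq_sum`
  -- requires.
  obtain ⟨j₂, hj₂⟩ := Finite.exists_ge fun k => 1 - (a k + n k)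
  obtain ⟨B, hB⟩ := Finite.exists_le n
  set j := min j₁ j₂ with hj
  set N := max B j with hN
  have hBN : ∀ k, n k ≤ N := fun k => (hB k).trans (le_max_left _ _)
  have hjn : ∀ k, j ≤ n k := fun k => (min_le_left _ _).trans (hj₁ k)
  have hja : ∀ k, j ≤ 1 - (a k + n k) := fun k => (min_le_right _ _).trans (hj₂ k)
  obtain ⟨Φ, hΦ⟩ := exists_dual_coords (μ := μ) (ν := nu p μ) (t := t) (c := j) (N := N)
    (fun i => -2 * i) n a N
  refine fredholm_of_kernel (t := t) (p := p) (μ := μ) (x₀ := fun i => -2 * i) (C := N) (c := j) (N := N)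
    (fun z w => by rw [kAlt, phiStar_eq hpar (hΓ₁ z w)]; rfl)
    (fun z w hz => kTildeAlt_eq_zero (hΓ₀ z w) t ?_) Φ hΦ (fun b hb b' => ?_) ?_
  · have := hBN w.1
    omega
  · have h1 := (mem_box.1 hb).2
    have h2 := hja b.1
    exact kTildeAlt_eq_sum (hΓ₀ _ _) t (hBN _) (by omega) (Φ b') (hΦ b')
  -- A head may be as far ahead as `j - t`; the particle in front of it must be observed too, whence
  -- the extra `1`.
  · refine IsGTASEP.measureReal_eq_detSol hX hpar (M := j - t - 1) (by omega) (le_max_right _ _)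
      (fun i _ _ => Set.mem_univ i) (fun i _ _ => by omega) hn.injective hjn hBN
      (fun k => by have := hBN k; omega) fun r hr => ?_
    filter_upwards [hX.exists_head j hr] with ω ⟨hlo, c, h1, h2, h3⟩
    refine ⟨c, by omega, h2, Or.inr ⟨by omega, h3⟩, fun i _ h5 k => ?_⟩
    have := hlo i
    have := hja k
    omega

end

end

end GTASEP

end

open GTASEP in
theorem theorem1 {Ω : Type*} [MeasurableSpace Ω] (P : Measure Ω) [IsProbabilityMeasure P]
    (p μ : ℝ) (hp₀ : 0 < p) (hp₁ : p < 1) (hμ₀ : 0 ≤ μ) (hμ₁ : μ < 1)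
    (X : ℕ → ℤ → Ω → ℤ) (t : ℕ) (m : ℕ) (n : Fin m → ℤ) (hn : StrictMono n) (a : Fin m → ℤ)
    (Γ₀ Γ₁ : Fin m × ℤ → Fin m × ℤ → SimpleLoop)
    (hΓ₀ : ∀ z w, IsLoopAroundZero μ (nu p μ) (Γ₀ z w))
    (hΓ₁ : ∀ z w, IsLoopAroundOne (nu p μ) (Γ₁ z w)) :
    (IsStepGTASEP P p μ X → (∀ k, 1 ≤ n k) → (∀ z w, MutuallyOutside (Γ₀ z w) (Γ₁ z w)) →
      let K : Fin m × ℤ → Fin m × ℤ → ℂ := cutKernel a fun z w =>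
        kStep p μ t (Γ₀ z w) (Γ₁ z w) (n z.1) z.2 (n w.1) w.2
      FredholmSummable K ∧ (P.real (⋂ k : Fin m, {ω | a k ≤ X t (n k) ω}) : ℂ) = fredholmDet K) ∧
    (IsAltGTASEP P p μ X →
      let K : Fin m × ℤ → Fin m × ℤ → ℂ := cutKernel a fun z w =>
        kAlt p μ t (Γ₀ z w) (Γ₁ z w) (n z.1) z.2 (n w.1) w.2
      FredholmSummable K ∧ (P.real (⋂ k : Fin m, {ω | a k ≤ X t (n k) ω}) : ℂ) = fredholmDet K) := by
  exact ⟨fun hX hn1 hout => step_formula hp₁ hμ₁ hn hΓ₀ hΓ₁ hX hn1 hout,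
    fun hX => alternating_formula hp₁ hμ₁ hn hΓ₀ hΓ₁ hX⟩
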